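/- A (real) weighing matrix $W(n,p)$ is an $n\times n$ matrix $W$ with entries in $\{0,1,-1\}$ such that $WW^{T}=pI_n$. Two such matrices are equivalent if one is obtained from the other by finitely many permutations of rows, permutations of columns, and multiplications of rows or columns by $-1$. Write $-$ for $-1$ and let $$W_7=\begin{pmatrix}1&1&1&1&0&0&0\\1&-&0&0&1&1&0\\1&0&-&0&-&0&1\\1&0&0&-&0&-&-\\0&1&-&0&0&1&-\\0&1&0&-&1&0&1\\0&0&1&-&-&1&0\end{pmatrix},\qquad W_8=\begin{pmatrix}1&1&1&1&0&0&0&0\\1&-&0&0&1&1&0&0\\1&0&-&0&-&0&1&0\\1&0&0&-&0&-&-&0\\0&1&-&0&1&0&0&1\\0&1&0&-&0&1&0&-\\0&0&1&-&0&0&1&1\\0&0&0&0&1&-&1&-\end{pmatrix}.$$ For $m\ge2$ let $E_{2m}(1)$ be the $2m\times 2m$ matrix made of $2\times2$ blocks $B_{pq}$, $1\le p,q\le m$, with $B_{11}=\begin{pmatrix}1&1\\1&1\end{pmatrix}$, $B_{mm}=\begin{pmatrix}1&-\\-&1\end{pmatrix}$, $B_{p,p+1}=\begin{pmatrix}1&1\\-&-\end{pmatrix}$,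 $B_{p+1,p}=\begin{pmatrix}1&-\\1&-\end{pmatrix}$ for $1\le p<m$, and all other blocks zero. Then: (1) Every $W(n,4)$ is equivalent to a block diagonal matrix each of whose diagonal blocks is $W_7$, $W_8$ or $E_{2m}(1)$ for some $m\ge2$. (2) For $n\ge4$, a $W(n,4)$ exists if and only if $n\ne5,9$. (3) For every $n$, the number of equivalence classes of $W(n,4)$ is at most the number of decompositions (disregarding order) of $n$ into a sum of parts $7$, $8$ and $2m$ with $m\ge2$, where a part $8$ that stands for $W_8$ is distinguished from a part $2m=8$ that stands for $E_8(1)$. Both numbers are finite. -/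

import Mathlib

/-- A (real) weighing matrix `W(n, p)`: a square matrix of order `n` with entries in `{0, 1, -1}`
such that `W * Wᵀ = p I`. -/
def IsWeighingMatrix {n : ℕ} (p : ℕ) (W : Matrix (Fin n) (Fin n) ℤ) : Prop :=
  (∀ i j, W i j = 0 ∨ W i j = 1 ∨ W i j = -1) ∧
    W * W.transpose = (p : ℤ) • (1 : Matrix (Fin n) (Fin n) ℤ)

/-- Equivalence of real weighing matrices: `B` arises from `A` by permuting rows, permuting columns,
and multiplying rows and columns by signs. -/
def WeighingEquiv {n : ℕ} (A B : Matrix (Fin n) (Fin n) ℤ) : Prop :=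
  ∃ (σ τ : Equiv.Perm (Fin n)) (d e : Fin n → ℤˣ),
    ∀ i j, B i j = (d i : ℤ) * A (σ i) (τ j) * (e j : ℤ)

theorem WeighingEquiv.refl {n : ℕ} (A : Matrix (Fin n) (Fin n) ℤ) : WeighingEquiv A A :=
  ⟨1, 1, 1, 1, by simp⟩

theorem WeighingEquiv.symm {n : ℕ} {A B : Matrix (Fin n) (Fin n) ℤ} (h : WeighingEquiv A B) :
    WeighingEquiv B A := by
  obtain ⟨σ, τ, d, e, h⟩ := h
  refine ⟨σ⁻¹, τ⁻¹, fun i => d (σ⁻¹ i), fun j => e (τ⁻¹ j), fun i j => ?_⟩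
  have h1 (u : ℤˣ) : (u : ℤ) * (u : ℤ) = 1 := by
    rcases Int.units_eq_one_or u with rfl | rfl <;> simp
  rw [h]
  simp only [Equiv.Perm.coe_inv, Equiv.apply_symm_apply]
  linear_combination (-A i j) * h1 (d (σ.symm i)) -
    A i j * (d (σ.symm i) : ℤ) * (d (σ.symm i) : ℤ) * h1 (e (τ.symm j))

theorem WeighingEquiv.trans {n : ℕ} {A B C : Matrix (Fin n) (Fin n) ℤ} (h : WeighingEquiv A B)
    (h' : WeighingEquiv B C) : WeighingEquiv A C := by
  obtain ⟨σ, τ, d, e, h⟩ := h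
  obtain ⟨σ', τ', d', e', h'⟩ := h'
  refine ⟨σ * σ', τ * τ', fun i => d' i * d (σ' i), fun j => e (τ' j) * e' j, fun i j => ?_⟩
  rw [h', h]
  simp only [Equiv.Perm.mul_apply, Units.val_mul]
  ring

/-- Equivalence as a setoid on the set of all `W(n, p)`. -/
def weighingSetoid (n p : ℕ) :
    Setoid {W : Matrix (Fin n) (Fin n) ℤ // IsWeighingMatrix p W} where
  r A B := WeighingEquiv A.1 B.1
  iseqv := ⟨fun A => WeighingEquiv.refl A.1, fun h => WeighingEquiv.symm h,
    fun h h' => WeighingEquiv.trans h h'⟩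

/-- The set of equivalence classes of `W(n, p)`. -/
def WeighingClass (n p : ℕ) : Type := Quotient (weighingSetoid n p)

/-- The block `W₇`. -/
def blockW7 : Matrix (Fin 7) (Fin 7) ℤ :=
  !![1,  1,  1,  1,  0,  0,  0;
     1, -1,  0,  0,  1,  1,  0;
     1,  0, -1,  0, -1,  0,  1;
     1,  0,  0, -1,  0, -1, -1;
     0,  1, -1,  0,  0,  1, -1;
     0,  1,  0, -1,  1,  0,  1;
     0,  0,  1, -1, -1,  1,  0]

/-- The block `W₈`. -/
def blockW8 : Matrix (Fin 8) (Fin 8) ℤ :=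
  !![1,  1,  1,  1,  0,  0,  0,  0;
     1, -1,  0,  0,  1,  1,  0,  0;
     1,  0, -1,  0, -1,  0,  1,  0;
     1,  0,  0, -1,  0, -1, -1,  0;
     0,  1, -1,  0,  1,  0,  0,  1;
     0,  1,  0, -1,  0,  1,  0, -1;
     0,  0,  1, -1,  0,  0,  1,  1;
     0,  0,  0,  0,  1, -1,  1, -1]

/-- The block `E_{2m}(x)`. Rows and columns are grouped in `m` consecutive pairs (numbered from `0`);
the `2 × 2` blocks in position `(p, q)` are
* `[1, 1; 1, 1]` for `p = q = 0`,
* `[x, -x; -x, x]` for `p = q = m - 1`,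
* `[1, 1; -1, -1]` for `q = p + 1`,
* `[1, -1; 1, -1]` for `p = q + 1`,
and zero otherwise. It is used for `m ≥ 2` only. -/
def blockE (m : ℕ) (x : ℤ) : Matrix (Fin (2 * m)) (Fin (2 * m)) ℤ :=
  Matrix.of fun i j =>
    if i.val / 2 = 0 ∧ j.val / 2 = 0 then 1
    else if i.val / 2 + 1 = m ∧ j.val / 2 + 1 = m then
      if i.val % 2 = j.val % 2 then x else -x
    else if j.val / 2 = i.val / 2 + 1 then
      if i.val % 2 = 0 then 1 else -1
    else if i.val / 2 = j.val / 2 + 1 then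
      if j.val % 2 = 0 then 1 else -1
    else 0

/-- The kinds of real diagonal blocks: `W₇`, `W₈`, and `E_{2m}(1)` with `m ≥ 2`. The kinds `W₈` and
`E₈(1)` are different although both have order `8`. -/
inductive RealBlock : Type
  | W7 : RealBlock
  | W8 : RealBlock
  | E (m : ℕ) (hm : 2 ≤ m) : RealBlock

/-- The order of a block. -/
def RealBlock.order : RealBlock → ℕ
  | .W7 => 7
  | .W8 => 8
  | .E m _ => 2 * m

/-- The matrix of a block. -/
def RealBlock.matrix : (b : RealBlock) → Matrix (Fin b.order) (Fin b.order) ℤ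
  | .W7 => blockW7
  | .W8 => blockW8
  | .E m _ => blockE m 1

/-- The block diagonal matrix with diagonal blocks `b 0, …, b (k - 1)`, in this order. -/
def blockSum {k : ℕ} (b : Fin k → RealBlock) :
    Matrix (Fin (∑ i, (b i).order)) (Fin (∑ i, (b i).order)) ℤ :=
  Matrix.reindex finSigmaFinEquiv finSigmaFinEquiv
    (Matrix.blockDiagonal' fun i => (b i).matrix)

/-- The decompositions of `n` into parts `7`, `8` and `2m`, `m ≥ 2`, irrespective of order: finite
multisets of block kinds of total order `n`. A part `8` of kind `W₈` is distinguished from a part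
`2m = 8`. -/
def BlockDecomposition (n : ℕ) : Type :=
  {s : Multiset RealBlock // (s.map RealBlock.order).sum = n}

/-!
The classification rests on a dichotomy for a matrix `W` of weight four, in terms of its `2 × 2`
submatrices without zeros, which have rank one or two.

Suppose first that some such submatrix, in rows `r, r'` and columns `a, b`, has rank one. The rows
then already have inner product `±2` on `a, b`, and since only two more nonzero entries are left in
each of them, orthogonality forces them to share their two remaining columns `x, y`, where they form
another rank-one block of the opposite sign (`IsWeightFour.exists_completion`). The same holds for
columns. So rank-one blocks come in chains, alternately continued along rows and along columns, and a
chain must close up. Growing a chain from one block at both ends yields the incomplete matrices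
`blockE m 0`, of which only the corner block is undetermined; orthogonality leaves one free entry
`α ∈ {0, 1, -1}` there (`IsBlockChain.exists_succ`). If `α = 0` the chain goes on, if `α = 1` it has
closed to `E_{2m}(1)`, and if `α = -1` it does so after an exchange of two columns.

If there is no rank-one submatrix, two rows that share a column share exactly two, with opposite
products, and likewise for columns: the support is a semibiplane with four points on a line. Starting
from one row, its incidences are determined up to a single alternative, which yields the supports of
`W₇` and of `W₈` (`IsSemibiplane.exists_pattern`). The signs can be normalised along a spanning tree,
and the remaining ones follow from `2 × 2` submatrices.

In both cases a block has been found whose rows and columns are full, so that it splits off as a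
direct summand, and induction on the order gives the first claim. For the second, `4`, `6`, `7`, `13`
and the steps by `4` account for all orders from `4` on other than `5` and `9`, and these two are not
sums of orders of blocks. For the third, the multiset of blocks found for a representative of a
class determines the class, since the order of the blocks does not matter.
-/

/-! ### Weight-four matrices and their supports -/

/-- A weighing matrix of weight `4` whose rows and columns are indexed by arbitrary finite types:
the entries lie in `{0, 1, -1}`, and both the rows and the columns are orthogonal of norm `4`.
Orthogonality of the columns is part of the definition so that the notion is visibly invariant
under transposition. -/
structure IsWeightFour {R C : Type*} [Fintype R] [Fintype C] (W : Matrix R C ℤ) : Prop where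
  entry : ∀ r c, W r c = 0 ∨ W r c = 1 ∨ W r c = -1
  row_orth : ∀ r r', r ≠ r' → ∑ c, W r c * W r' c = 0
  row_norm : ∀ r, ∑ c, W r c * W r c = 4
  col_orth : ∀ c c', c ≠ c' → ∑ r, W r c * W r c' = 0
  col_norm : ∀ c, ∑ r, W r c * W r c = 4

namespace IsWeightFour

variable {R C : Type*} [Fintype R] [Fintype C] {W : Matrix R C ℤ}

theorem transpose (h : IsWeightFour W) : IsWeightFour W.transpose :=
  ⟨fun r c => h.entry c r, h.col_orth, h.col_norm, h.row_orth, h.row_norm⟩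

theorem scale (h : IsWeightFour W) (d : R → ℤˣ) (e : C → ℤˣ) :
    IsWeightFour (Matrix.of fun r c => (d r : ℤ) * W r c * e c) := by
  have sq (u : ℤˣ) : (u : ℤ) * u = 1 := by rcases Int.units_eq_one_or u with rfl | rfl <;> simp
  refine ⟨fun r c => ?_, fun r r' hr => ?_, fun r => ?_, fun c c' hc => ?_, fun c => ?_⟩
  · rcases Int.units_eq_one_or (d r) with h1 | h1 <;> rcases Int.units_eq_one_or (e c) with h2 | h2 <;>
      rcases h.entry r c with h3 | h3 | h3 <;> simp [h1, h2, h3]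
  · calc _ = ∑ c, (d r * d r' : ℤ) * (W r c * W r' c) := Finset.sum_congr rfl fun c _ => by
          simp only [Matrix.of_apply]
          linear_combination (d r * d r' : ℤ) * (W r c * W r' c) * sq (e c)
      _ = 0 := by rw [← Finset.mul_sum, h.row_orth r r' hr, mul_zero]
  · calc _ = ∑ c, W r c * W r c := Finset.sum_congr rfl fun c _ => by
          simp only [Matrix.of_apply]
          linear_combination (d r * d r : ℤ) * (W r c * W r c) * sq (e c) + W r c * W r c * sq (d r)
      _ = 4 := h.row_norm r
  · calc _ = ∑ r, (e c * e c' : ℤ) * (W r c * W r c') := Finset.sum_congr rfl fun r _ => by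
          simp only [Matrix.of_apply]
          linear_combination (e c * e c' : ℤ) * (W r c * W r c') * sq (d r)
      _ = 0 := by rw [← Finset.mul_sum, h.col_orth c c' hc, mul_zero]
  · calc _ = ∑ r, W r c * W r c := Finset.sum_congr rfl fun r _ => by
          simp only [Matrix.of_apply]
          linear_combination (e c * e c : ℤ) * (W r c * W r c) * sq (d r) + W r c * W r c * sq (e c)
      _ = 4 := h.col_norm c

theorem card_support (h : IsWeightFour W) (r : R) :
    (Finset.univ.filter fun c => W r c ≠ 0).card = 4 := by
  have h1 := h.row_norm r
  have h2 : ∑ c, W r c * W r c = ∑ c, if W r c ≠ 0 then (1 : ℤ) else 0 :=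
    Finset.sum_congr rfl fun c _ => by rcases h.entry r c with h3 | h3 | h3 <;> simp [h3]
  rw [h2, Finset.sum_boole] at h1
  exact_mod_cast h1

/-- Four nonzero entries exhaust the support of a row. -/
theorem eq_of_ne_zero (h : IsWeightFour W) {r : R} {a b c d : C} (hab : a ≠ b) (hac : a ≠ c)
    (had : a ≠ d) (hbc : b ≠ c) (hbd : b ≠ d) (hcd : c ≠ d) (ha : W r a ≠ 0) (hb : W r b ≠ 0)
    (hc : W r c ≠ 0) (hd : W r d ≠ 0) {x : C} (hx : W r x ≠ 0) :
    x = a ∨ x = b ∨ x = c ∨ x = d := by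
  classical
  have h1 : ({a, b, c, d} : Finset C) = Finset.univ.filter fun c => W r c ≠ 0 := by
    apply Finset.eq_of_subset_of_card_le
    · intro z
      simp only [Finset.mem_insert, Finset.mem_singleton, Finset.mem_filter, Finset.mem_univ,
        true_and]
      rintro (rfl | rfl | rfl | rfl) <;> assumption
    · rw [h.card_support r, Finset.card_insert_of_notMem, Finset.card_insert_of_notMem, Finset.card_pair hcd] <;>
        simp [*]
  have h2 : x ∈ ({a, b, c, d} : Finset C) := by rw [h1]; simpa using hx
  simpa using h2

/-- A row with four nonzero entries in the columns `g j`, `j ∈ s`, vanishes in all other columns. -/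
theorem eq_zero_of_forall_ne (h : IsWeightFour W) {ι : Type*} {r : R} {g : ι → C}
    (hg : Function.Injective g) {s : Finset ι} (hs : 4 ≤ s.card) (hne : ∀ j ∈ s, W r (g j) ≠ 0)
    {c : C} (hc : ∀ j ∈ s, g j ≠ c) : W r c = 0 := by
  classical
  have h1 : s.image g = Finset.univ.filter fun c => W r c ≠ 0 := by
    apply Finset.eq_of_subset_of_card_le
    · intro c hc
      obtain ⟨j, hj, rfl⟩ := Finset.mem_image.1 hc
      simpa using hne j hj
    · rw [h.card_support, Finset.card_image_of_injective _ hg]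
      exact hs
  by_contra h2
  have h3 : c ∈ s.image g := by rw [h1]; simpa using h2
  obtain ⟨j, hj, h4⟩ := Finset.mem_image.1 h3
  exact hc j hj h4

/-- Two nonzero entries of a row extend to its full support. -/
theorem exists_support (h : IsWeightFour W) {r : R} {a b : C} (hab : a ≠ b) (ha : W r a ≠ 0)
    (hb : W r b ≠ 0) : ∃ x y, x ≠ y ∧ a ≠ x ∧ a ≠ y ∧ b ≠ x ∧ b ≠ y ∧ W r x ≠ 0 ∧ W r y ≠ 0 := by
  classical
  have h1 : (((Finset.univ.filter fun c => W r c ≠ 0).erase a).erase b).card = 2 := by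
    rw [Finset.card_erase_of_mem, Finset.card_erase_of_mem, h.card_support] <;> simp [ha, hb, hab.symm]
  obtain ⟨x, y, hxy, h2⟩ := Finset.card_eq_two.1 h1
  have hx : x ∈ ({x, y} : Finset C) := by simp
  have hy : y ∈ ({x, y} : Finset C) := by simp
  rw [← h2] at hx hy
  simp only [Finset.mem_erase, Finset.mem_filter, Finset.mem_univ, true_and] at hx hy
  exact ⟨x, y, hxy, hx.2.1.symm, hy.2.1.symm, hx.1.symm, hy.1.symm, hx.2.2, hy.2.2⟩

theorem exists_two (h : IsWeightFour W) (r : R) : ∃ a b, a ≠ b ∧ W r a ≠ 0 ∧ W r b ≠ 0 := by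
  obtain ⟨a, ha, b, hb, hab⟩ := Finset.one_lt_card.1 (by rw [h.card_support r]; norm_num :
    1 < (Finset.univ.filter fun c => W r c ≠ 0).card)
  exact ⟨a, b, hab, by simpa using ha, by simpa using hb⟩

/-- Orthogonality of two rows, evaluated on the support of the first one. -/
theorem sum_support (h : IsWeightFour W) {r r' : R} (hr : r ≠ r') {a b c d : C} (hab : a ≠ b)
    (hac : a ≠ c) (had : a ≠ d) (hbc : b ≠ c) (hbd : b ≠ d) (hcd : c ≠ d) (ha : W r a ≠ 0)
    (hb : W r b ≠ 0) (hc : W r c ≠ 0) (hd : W r d ≠ 0) :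
    W r a * W r' a + W r b * W r' b + W r c * W r' c + W r d * W r' d = 0 := by
  classical
  rw [← h.row_orth r r' hr, ← Finset.sum_subset (Finset.subset_univ {a, b, c, d})]
  · rw [Finset.sum_insert, Finset.sum_insert, Finset.sum_pair hcd]
    · ring
    all_goals simp [*]
  · intro x _ hx
    by_contra h1
    apply hx
    simpa using h.eq_of_ne_zero hab hac had hbc hbd hcd ha hb hc hd (left_ne_zero_of_mul h1)

/-- Two rows that are proportional on two columns of their common support have the same support,
and their products on the two other columns have the opposite sign. -/
theorem exists_completion (h : IsWeightFour W) {r r' : R} (hr : r ≠ r') {a b : C} (hab : a ≠ b)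
    (ha : W r a ≠ 0) (ha' : W r' a ≠ 0) (hb : W r b ≠ 0)
    (heq : W r a * W r' a = W r b * W r' b) :
    ∃ x y, x ≠ y ∧ a ≠ x ∧ a ≠ y ∧ b ≠ x ∧ b ≠ y ∧ W r x ≠ 0 ∧ W r y ≠ 0 ∧
      W r x * W r' x = -(W r a * W r' a) ∧ W r y * W r' y = -(W r a * W r' a) := by
  obtain ⟨x, y, hxy, hax, hay, hbx, hby, hx, hy⟩ := h.exists_support hab ha hb
  have h1 := h.sum_support hr hab hax hay hbx hby hxy ha hb hx hy
  refine ⟨x, y, hxy, hax, hay, hbx, hby, hx, hy, ?_⟩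
  rw [← heq] at h1
  have key : ∀ z, W r z * W r' z = 0 ∨ W r z * W r' z = 1 ∨ W r z * W r' z = -1 := fun z => by
    rcases h.entry r z with h2 | h2 | h2 <;> rcases h.entry r' z with h3 | h3 | h3 <;> simp [h2, h3]
  have hne := mul_ne_zero ha ha'
  rcases key a with h2 | h2 | h2 <;> rcases key x with h3 | h3 | h3 <;>
    rcases key y with h4 | h4 | h4 <;> omega

end IsWeightFour

/-- The sign of an entry of a weighing matrix, as a unit; the value at `0` is irrelevant. -/
def entrySign (z : ℤ) : ℤˣ := if z = -1 then -1 else 1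

theorem entrySign_eq {R C : Type*} [Fintype R] [Fintype C] {W : Matrix R C ℤ} (h : IsWeightFour W)
    {r : R} {c : C} (hne : W r c ≠ 0) : (entrySign (W r c) : ℤ) = W r c := by
  rcases h.entry r c with h1 | h1 | h1
  · exact absurd h1 hne
  all_goals simp [entrySign, h1]

theorem IsWeightFour.mul_self_eq_one {R C : Type*} [Fintype R] [Fintype C] {W : Matrix R C ℤ}
    (h : IsWeightFour W) {r : R} {c : C} (hne : W r c ≠ 0) : W r c * W r c = 1 := by
  rcases h.entry r c with h1 | h1 | h1
  · exact absurd h1 hne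
  all_goals simp [h1]

/-- The matrix `B` occurs in `W`, up to signs, in the rows `f` and the columns `g`. -/
def EmbedsIn {R C : Type*} {k : ℕ} (B : Matrix (Fin k) (Fin k) ℤ) (W : Matrix R C ℤ) : Prop :=
  ∃ (f : Fin k → R) (g : Fin k → C) (d e : Fin k → ℤˣ), Function.Injective f ∧
    Function.Injective g ∧ ∀ i j, W (f i) (g j) = (d i : ℤ) * B i j * e j

/-! ### Chains of rank-one blocks -/

/-- The entries of `blockE m x`, as a function on pairs of natural numbers. -/
def chainEntry (m : ℕ) (x : ℤ) (i j : ℕ) : ℤ :=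
  if i / 2 = 0 ∧ j / 2 = 0 then 1
  else if i / 2 + 1 = m ∧ j / 2 + 1 = m then
    if i % 2 = j % 2 then x else -x
  else if j / 2 = i / 2 + 1 then
    if i % 2 = 0 then 1 else -1
  else if i / 2 = j / 2 + 1 then
    if j % 2 = 0 then 1 else -1
  else 0

theorem blockE_apply (m : ℕ) (x : ℤ) (i j : Fin (2 * m)) : blockE m x i j = chainEntry m x i j :=
  rfl

theorem chainEntry_comm (m : ℕ) (x : ℤ) (i j : ℕ) : chainEntry m x i j = chainEntry m x j i := by
  unfold chainEntry
  split_ifs <;> omega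

theorem chainEntry_succ {m : ℕ} (x : ℤ) {i j : ℕ} (hj : j < 2 * m) :
    chainEntry (m + 1) x i j = chainEntry m 0 i j := by
  unfold chainEntry
  split_ifs <;> omega

/-- A row of `blockE m x` has four nonzero entries, unless it is one of the last two rows and
`x = 0`. -/
theorem exists_chainEntry_ne_zero {m : ℕ} {x : ℤ} {i : ℕ} (hm : 2 ≤ m) (hi : i < 2 * m)
    (hx : i / 2 + 1 = m → x ≠ 0) : ∃ a b, a + 1 < b ∧ b + 1 < 2 * m ∧ chainEntry m x i a ≠ 0 ∧
      chainEntry m x i (a + 1) ≠ 0 ∧ chainEntry m x i b ≠ 0 ∧ chainEntry m x i (b + 1) ≠ 0 := by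
  refine ⟨2 * (i / 2 - 1), 2 * min (i / 2 + 1) (m - 1), by omega, by omega, ?_, ?_, ?_, ?_⟩
  all_goals
    unfold chainEntry
    split_ifs <;> omega

/-- The matrix `blockE m x` occurs in `W` in the rows `ρ 0, …, ρ (2 m - 1)` and the columns
`γ 0, …, γ (2 m - 1)`. For `x = 0` the block is incomplete: its last two rows and columns have
further nonzero entries elsewhere in `W`. -/
structure IsBlockChain {R C : Type*} (W : Matrix R C ℤ) (m : ℕ) (x : ℤ) (ρ : ℕ → R) (γ : ℕ → C) :
    Prop where
  injOn_row : ∀ i j, i < 2 * m → j < 2 * m → ρ i = ρ j → i = j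
  injOn_col : ∀ i j, i < 2 * m → j < 2 * m → γ i = γ j → i = j
  apply_eq : ∀ i j, i < 2 * m → j < 2 * m → W (ρ i) (γ j) = chainEntry m x i j

namespace IsBlockChain

variable {R C : Type*} {W : Matrix R C ℤ} {m : ℕ} {x : ℤ} {ρ : ℕ → R} {γ : ℕ → C}

theorem transpose (hc : IsBlockChain W m x ρ γ) : IsBlockChain W.transpose m x γ ρ :=
  ⟨hc.injOn_col, hc.injOn_row, fun i j hi hj => by
    rw [Matrix.transpose_apply, hc.apply_eq j i hj hi, chainEntry_comm]⟩

/-- Exchanging the last two columns changes the sign of the corner block. -/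
theorem swap_last (hc : IsBlockChain W (m + 1) (-x) ρ γ) (hm : 1 ≤ m) :
    IsBlockChain W (m + 1) x ρ (γ ∘ Equiv.swap (2 * m) (2 * m + 1)) := by
  have hlt : ∀ j < 2 * (m + 1), Equiv.swap (2 * m) (2 * m + 1) j < 2 * (m + 1) := fun j hj => by
    rw [Equiv.swap_apply_def]; split_ifs <;> omega
  refine ⟨hc.injOn_row, fun i j hi hj hij => ?_, fun i j hi hj => ?_⟩
  · exact (Equiv.swap _ _).injective (hc.injOn_col _ _ (hlt i hi) (hlt j hj) hij)
  · rw [Function.comp_apply, hc.apply_eq i _ hi (hlt j hj)]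
    have hj' : j < 2 * m ∨ j = 2 * m ∨ j = 2 * m + 1 := by omega
    rcases hj' with hj' | rfl | rfl
    · rw [Equiv.swap_apply_of_ne_of_ne (by omega) (by omega), chainEntry_succ _ hj',
        chainEntry_succ _ hj']
    · rw [Equiv.swap_apply_left]
      unfold chainEntry
      split_ifs <;> omega
    · rw [Equiv.swap_apply_right]
      unfold chainEntry
      split_ifs <;> omega

theorem embedsIn {d : R → ℤˣ} {e : C → ℤˣ}
    (hc : IsBlockChain (Matrix.of fun r c => (d r : ℤ) * W r c * e c) m x ρ γ) :
    EmbedsIn (blockE m x) W := by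
  have sq (u : ℤˣ) : (u : ℤ) * u = 1 := by rcases Int.units_eq_one_or u with rfl | rfl <;> simp
  refine ⟨fun i => ρ i, fun j => γ j, fun i => d (ρ i), fun j => e (γ j),
    fun i j hij => Fin.ext (hc.injOn_row _ _ i.2 j.2 hij),
    fun i j hij => Fin.ext (hc.injOn_col _ _ i.2 j.2 hij), fun i j => ?_⟩
  rw [blockE_apply, ← hc.apply_eq i j i.2 j.2, Matrix.of_apply]
  linear_combination (-W (ρ i) (γ j)) * sq (d (ρ i)) -
    W (ρ i) (γ j) * (d (ρ i) * d (ρ i) : ℤ) * sq (e (γ j))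

variable [Fintype R] [Fintype C]

/-- The two columns by which a chain continues: the remaining support of its last pair of rows. -/
theorem exists_new_cols (hc : IsBlockChain W m 0 ρ γ) (h : IsWeightFour W) (hm : 1 ≤ m) :
    ∃ x y, x ≠ y ∧ (∀ j < 2 * m, γ j ≠ x ∧ γ j ≠ y) ∧
      W (ρ (2 * m - 2)) x ≠ 0 ∧ W (ρ (2 * m - 2)) y ≠ 0 ∧
      W (ρ (2 * m - 2)) x * W (ρ (2 * m - 1)) x = -1 ∧
      W (ρ (2 * m - 2)) y * W (ρ (2 * m - 1)) y = -1 ∧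
      ∀ i < 2 * m - 2, W (ρ i) x = 0 ∧ W (ρ i) y = 0 := by
  -- the pair of columns already used by the last pair of rows; for `m = 1` it is the pair `0, 1`
  have e1 : W (ρ (2 * m - 2)) (γ (2 * (m - 2))) = 1 := by
    rw [hc.apply_eq _ _ (by omega) (by omega)]; unfold chainEntry; split_ifs <;> omega
  have e2 : W (ρ (2 * m - 1)) (γ (2 * (m - 2))) = 1 := by
    rw [hc.apply_eq _ _ (by omega) (by omega)]; unfold chainEntry; split_ifs <;> omega
  have e3 : W (ρ (2 * m - 2)) (γ (2 * (m - 2) + 1)) = W (ρ (2 * m - 1)) (γ (2 * (m - 2) + 1)) := by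
    rw [hc.apply_eq _ _ (by omega) (by omega), hc.apply_eq _ _ (by omega) (by omega)]
    unfold chainEntry; split_ifs <;> omega
  have e4 : W (ρ (2 * m - 2)) (γ (2 * (m - 2) + 1)) ≠ 0 := by
    rw [hc.apply_eq _ _ (by omega) (by omega)]; unfold chainEntry; split_ifs <;> omega
  have hr : ρ (2 * m - 2) ≠ ρ (2 * m - 1) := fun h1 => by
    have := hc.injOn_row _ _ (by omega) (by omega) h1; omega
  have hab : γ (2 * (m - 2)) ≠ γ (2 * (m - 2) + 1) := fun h1 => by
    have := hc.injOn_col _ _ (by omega) (by omega) h1; omega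
  obtain ⟨x, y, hxy, hax, hay, hbx, hby, hx, hy, px, py⟩ := h.exists_completion hr hab
    (by rw [e1]; norm_num) (by rw [e2]; norm_num) e4
    (by rw [← e3, h.mul_self_eq_one e4, e1, e2]; norm_num)
  rw [e1, e2] at px py
  have hnew : ∀ z, γ (2 * (m - 2)) ≠ z → γ (2 * (m - 2) + 1) ≠ z → W (ρ (2 * m - 2)) z ≠ 0 →
      ∀ j < 2 * m, γ j ≠ z := by
    rintro z h1 h2 h3 j hj rfl
    have h4 : j ≠ 2 * (m - 2) := fun h5 => h1 (by rw [h5])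
    have h6 : j ≠ 2 * (m - 2) + 1 := fun h5 => h2 (by rw [h5])
    apply h3
    rw [hc.apply_eq _ _ (by omega) hj]; unfold chainEntry; split_ifs <;> omega
  have hzero : ∀ z, (∀ j < 2 * m, γ j ≠ z) → ∀ i < 2 * m - 2, W (ρ i) z = 0 := by
    intro z hz i hi
    by_contra h1
    obtain ⟨a, b, h2, h3, h4, h5, h6, h7⟩ := exists_chainEntry_ne_zero (m := m) (x := 0) (i := i)
      (by omega) (by omega) (by omega)
    rw [← hc.apply_eq _ _ (by omega) (by omega)] at h4 h5 h6 h7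
    have hinj : ∀ k l, k < l → l < 2 * m → γ k ≠ γ l := fun k l hkl hl h8 => by
      have := hc.injOn_col _ _ (by omega) (by omega) h8; omega
    rcases h.eq_of_ne_zero (hinj _ _ (by omega) (by omega)) (hinj _ _ (by omega) (by omega))
      (hinj _ _ (by omega) (by omega)) (hinj _ _ (by omega) (by omega))
      (hinj _ _ (by omega) (by omega)) (hinj _ _ (by omega) (by omega)) h4 h5 h6 h7 h1
      with h8 | h8 | h8 | h8 <;> exact hz _ (by omega) h8.symm
  have hx' := hnew x hax hbx hx
  have hy' := hnew y hay hby hy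
  exact ⟨x, y, hxy, fun j hj => ⟨hx' j hj, hy' j hj⟩, hx, hy, by linarith, by linarith,
    fun i hi => ⟨hzero x hx' i hi, hzero y hy' i hi⟩⟩

/-- A new row `s` of a chain takes opposite values on the two new columns, by orthogonality to the last
old row. Together with the dual statement this leaves one free entry in the new corner. -/
theorem corner (hc : IsBlockChain W m 0 ρ γ) (h : IsWeightFour W) (hm : 1 ≤ m) {x y : C} {s : R}
    (hxy : x ≠ y) (hx : ∀ j < 2 * m, γ j ≠ x) (hy : ∀ j < 2 * m, γ j ≠ y)
    (hs : ∀ i < 2 * m, ρ i ≠ s)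
    (hrx : W (ρ (2 * m - 2)) x = 1) (hry : W (ρ (2 * m - 2)) y = 1)
    (hs1 : W s (γ (2 * m - 2)) = 1) (hs2 : W s (γ (2 * m - 1)) = -1)
    (hs0 : ∀ j < 2 * m - 2, W s (γ j) = 0) : W s y = -W s x := by
  have hab : γ (2 * (m - 2)) ≠ γ (2 * (m - 2) + 1) := fun h1 => by
    have := hc.injOn_col _ _ (by omega) (by omega) h1; omega
  have e1 : W (ρ (2 * m - 2)) (γ (2 * (m - 2))) ≠ 0 := by
    rw [hc.apply_eq _ _ (by omega) (by omega)]; unfold chainEntry; split_ifs <;> omega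
  have e2 : W (ρ (2 * m - 2)) (γ (2 * (m - 2) + 1)) ≠ 0 := by
    rw [hc.apply_eq _ _ (by omega) (by omega)]; unfold chainEntry; split_ifs <;> omega
  have h1 := h.sum_support (hs (2 * m - 2) (by omega)) hab (hx _ (by omega)) (hy _ (by omega))
    (hx _ (by omega)) (hy _ (by omega)) hxy e1 e2 (by rw [hrx]; norm_num) (by rw [hry]; norm_num)
  rw [hrx, hry] at h1
  rcases eq_or_lt_of_le hm with rfl | hm2
  · rw [hc.apply_eq _ _ (by omega) (by omega), hc.apply_eq _ _ (by omega) (by omega)] at h1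
    simp [chainEntry] at h1 hs1 hs2
    rw [hs1, hs2] at h1
    linarith
  · rw [hs0 _ (by omega), hs0 _ (by omega)] at h1
    linarith

/-- Extension of a chain whose new rows and columns have been normalised. -/
theorem extend (hc : IsBlockChain W m 0 ρ γ) (h : IsWeightFour W) (hm : 1 ≤ m) {x y : C} {s t : R}
    (hxy : x ≠ y) (hx : ∀ j < 2 * m, γ j ≠ x) (hy : ∀ j < 2 * m, γ j ≠ y)
    (hst : s ≠ t) (hs : ∀ i < 2 * m, ρ i ≠ s) (ht : ∀ i < 2 * m, ρ i ≠ t)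
    (hrx : W (ρ (2 * m - 2)) x = 1) (hry : W (ρ (2 * m - 2)) y = 1)
    (hrx' : W (ρ (2 * m - 1)) x = -1) (hry' : W (ρ (2 * m - 1)) y = -1)
    (hr0 : ∀ i < 2 * m - 2, W (ρ i) x = 0 ∧ W (ρ i) y = 0)
    (hs1 : W s (γ (2 * m - 2)) = 1) (ht1 : W t (γ (2 * m - 2)) = 1)
    (hs2 : W s (γ (2 * m - 1)) = -1) (ht2 : W t (γ (2 * m - 1)) = -1)
    (hs0 : ∀ j < 2 * m - 2, W s (γ j) = 0 ∧ W t (γ j) = 0) :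
    IsBlockChain W (m + 1) (W s x) (fun i => if i < 2 * m then ρ i else if i = 2 * m then s else t)
      (fun i => if i < 2 * m then γ i else if i = 2 * m then x else y) := by
  have c1 := hc.corner h hm hxy hx hy hs hrx hry hs1 hs2 fun j hj => (hs0 j hj).1
  have c2 := hc.corner h hm hxy hx hy ht hrx hry ht1 ht2 fun j hj => (hs0 j hj).2
  have c3 := hc.transpose.corner h.transpose hm hst hs ht hx hs1 ht1 hrx hrx' fun j hj => (hr0 j hj).1
  simp only [Matrix.transpose_apply] at c3
  refine ⟨fun i j hi hj hij => ?_, fun i j hi hj hij => ?_, fun i j hi hj => ?_⟩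
  · have h1 := hc.injOn_row i j
    have h2 := hs i
    have h3 := hs j
    have h4 := ht i
    have h5 := ht j
    grind
  · have h1 := hc.injOn_col i j
    have h2 := hx i
    have h3 := hx j
    have h4 := hy i
    have h5 := hy j
    grind
  · by_cases hi1 : i < 2 * m
    · by_cases hj1 : j < 2 * m
      · simp only [hi1, hj1, if_true]
        rw [hc.apply_eq i j hi1 hj1, chainEntry_succ _ hj1]
      · have hj2 : j = 2 * m ∨ j = 2 * m + 1 := by omega
        have hi2 : i < 2 * m - 2 ∨ i = 2 * m - 2 ∨ i = 2 * m - 1 := by omega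
        rcases hi2 with hi2 | hi2 | hi2
        · have h0 := hr0 i hi2
          rcases hj2 with rfl | rfl <;> simp [hi1, h0, chainEntry] <;> split_ifs <;> omega
        · rw [if_pos hi1]
          subst hi2
          rcases hj2 with rfl | rfl <;> simp [hrx, hry, chainEntry] <;> split_ifs <;> omega
        · rw [if_pos hi1]
          subst hi2
          rcases hj2 with rfl | rfl <;> simp [hrx', hry', chainEntry] <;> split_ifs <;> omega
    · have hi2 : i = 2 * m ∨ i = 2 * m + 1 := by omega
      by_cases hj1 : j < 2 * m
      · have hj2 : j < 2 * m - 2 ∨ j = 2 * m - 2 ∨ j = 2 * m - 1 := by omega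
        rcases hj2 with hj2 | hj2 | hj2
        · have h0 := hs0 j hj2
          rcases hi2 with rfl | rfl <;> simp [hj1, h0, chainEntry] <;> split_ifs <;> omega
        · rw [if_pos hj1]
          subst hj2
          rcases hi2 with rfl | rfl <;> simp [hs1, ht1, chainEntry] <;> split_ifs <;> omega
        · rw [if_pos hj1]
          subst hj2
          rcases hi2 with rfl | rfl <;> simp [hs2, ht2, chainEntry] <;> split_ifs <;> omega
      · have hj2 : j = 2 * m ∨ j = 2 * m + 1 := by omega
        rcases hi2 with rfl | rfl <;> rcases hj2 with rfl | rfl <;>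
          simp [c1, c2, c3, chainEntry] <;> omega

/-- One step along the chain, after a suitable change of signs of `W`. -/
theorem exists_succ (hc : IsBlockChain W m 0 ρ γ) (h : IsWeightFour W) (hm : 1 ≤ m) :
    ∃ (d : R → ℤˣ) (e : C → ℤˣ) (ρ' : ℕ → R) (γ' : ℕ → C) (α : ℤ), (α = 0 ∨ α = 1 ∨ α = -1) ∧
      IsBlockChain (Matrix.of fun r c => (d r : ℤ) * W r c * e c) (m + 1) α ρ' γ' := by
  classical
  obtain ⟨x, y, hxy, hnew, hx, hy, px, py, hr0⟩ := hc.exists_new_cols h hm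
  obtain ⟨s, t, hst, hnew', hs, ht, ps, pt, hs0⟩ := hc.transpose.exists_new_cols h.transpose hm
  simp only [Matrix.transpose_apply] at hs ht ps pt hs0
  let d : R → ℤˣ := fun q => if q = s ∨ q = t then entrySign (W q (γ (2 * m - 2))) else 1
  let e : C → ℤˣ := fun z => if z = x ∨ z = y then entrySign (W (ρ (2 * m - 2)) z) else 1
  have hd : ∀ i < 2 * m, d (ρ i) = 1 := fun i hi => by simp [d, hnew' i hi]
  have he : ∀ i < 2 * m, e (γ i) = 1 := fun i hi => by simp [e, hnew i hi]
  have hds : (d s : ℤ) = W s (γ (2 * m - 2)) := by simp [d, entrySign_eq h hs]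
  have hdt : (d t : ℤ) = W t (γ (2 * m - 2)) := by simp [d, entrySign_eq h ht]
  have hex : (e x : ℤ) = W (ρ (2 * m - 2)) x := by simp [e, entrySign_eq h hx]
  have hey : (e y : ℤ) = W (ρ (2 * m - 2)) y := by simp [e, entrySign_eq h hy]
  have hW := h.scale d e
  have hc' : IsBlockChain (Matrix.of fun r c => (d r : ℤ) * W r c * e c) m 0 ρ γ :=
    ⟨hc.injOn_row, hc.injOn_col, fun i j hi hj => by
      simp [hd i hi, he j hj, hc.apply_eq i j hi hj]⟩
  have h2 : 2 * m - 2 < 2 * m := by omega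
  have h1 : 2 * m - 1 < 2 * m := by omega
  have key := hc'.extend hW hm hxy (fun j hj => (hnew j hj).1) (fun j hj => (hnew j hj).2) hst
    (fun j hj => (hnew' j hj).1) (fun j hj => (hnew' j hj).2)
    (by simp [hd _ h2, hex, h.mul_self_eq_one hx]) (by simp [hd _ h2, hey, h.mul_self_eq_one hy])
    (by simp [hd _ h1, hex]; linarith) (by simp [hd _ h1, hey]; linarith)
    (fun i hi => by simp [hr0 i hi])
    (by simp [he _ h2, hds, h.mul_self_eq_one hs]) (by simp [he _ h2, hdt, h.mul_self_eq_one ht])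
    (by simp [he _ h1, hds]; linarith) (by simp [he _ h1, hdt]; linarith)
    (fun i hi => by simp [hs0 i hi])
  exact ⟨d, e, _, _, _, hW.entry s x, key⟩

/-- A chain that is not closed can be continued until it closes. Here `k` bounds the number of steps for
which `W` still has enough rows. -/
theorem exists_blockE (h : IsWeightFour W) : ∀ (k m : ℕ), 1 ≤ m → Fintype.card R < 2 * m + k →
    ∀ (d : R → ℤˣ) (e : C → ℤˣ) (ρ : ℕ → R) (γ : ℕ → C),
      IsBlockChain (Matrix.of fun r c => (d r : ℤ) * W r c * e c) m 0 ρ γ →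
      ∃ M, 2 ≤ M ∧ EmbedsIn (blockE M 1) W := by
  intro k
  induction k with
  | zero =>
    intro m _ hk d e ρ γ hc
    have h1 := Fintype.card_le_of_injective (fun i : Fin (2 * m) => ρ i)
      fun i j hij => Fin.ext (hc.injOn_row _ _ i.2 j.2 hij)
    rw [Fintype.card_fin] at h1
    omega
  | succ k ih =>
    intro m hm hk d e ρ γ hc
    obtain ⟨d', e', ρ', γ', α, hα, hc'⟩ := hc.exists_succ (h.scale d e) hm
    have hcomp : (Matrix.of fun r c => (d' r : ℤ) * (Matrix.of fun r c => (d r : ℤ) * W r c * e c) r c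
        * e' c) = Matrix.of fun r c => ((d' * d) r : ℤ) * W r c * (e * e') c := by
      ext r c
      simp only [Matrix.of_apply, Pi.mul_apply, Units.val_mul]
      ring
    rw [hcomp] at hc'
    rcases hα with rfl | rfl | rfl
    · exact ih (m + 1) (by omega) (by omega) _ _ _ _ hc'
    · exact ⟨m + 1, by omega, hc'.embedsIn⟩
    · exact ⟨m + 1, by omega, (hc'.swap_last hm).embedsIn⟩

end IsBlockChain

/-- A rank-one `2 × 2` block without zeros starts a chain. -/
theorem IsWeightFour.exists_blockE {R C : Type*} [Fintype R] [Fintype C] {W : Matrix R C ℤ}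
    (h : IsWeightFour W) {r r' : R} {a b : C} (hr : r ≠ r') (hab : a ≠ b) (ha : W r a ≠ 0)
    (ha' : W r' a ≠ 0) (hb : W r b ≠ 0) (hb' : W r' b ≠ 0)
    (heq : W r a * W r' a = W r b * W r' b) : ∃ M, 2 ≤ M ∧ EmbedsIn (blockE M 1) W := by
  classical
  let d : R → ℤˣ := fun q => if q = r ∨ q = r' then entrySign (W q a) else 1
  let e : C → ℤˣ := fun z => if z = b then entrySign (W r a) * entrySign (W r b) else 1
  have hd : (d r : ℤ) = W r a := by simp [d, entrySign_eq h ha]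
  have hd' : (d r' : ℤ) = W r' a := by simp [d, entrySign_eq h ha']
  have hea : e a = 1 := by simp [e, hab]
  have heb : (e b : ℤ) = W r a * W r b := by simp [e, entrySign_eq h ha, entrySign_eq h hb]
  have s1 := h.mul_self_eq_one ha
  have s2 := h.mul_self_eq_one ha'
  have s3 := h.mul_self_eq_one hb
  have s4 := h.mul_self_eq_one hb'
  refine IsBlockChain.exists_blockE h (Fintype.card R) 1 le_rfl (by omega) d e
    (fun i => if i = 0 then r else r') (fun i => if i = 0 then a else b) ⟨?_, ?_, ?_⟩
  · intro i j hi hj hij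
    grind
  · intro i j hi hj hij
    grind
  · intro i j hi hj
    have e1 : chainEntry 1 0 i j = 1 := by unfold chainEntry; split_ifs <;> omega
    rw [e1, Matrix.of_apply]
    have hi' : i = 0 ∨ i = 1 := by omega
    have hj' : j = 0 ∨ j = 1 := by omega
    rcases hi' with rfl | rfl <;> rcases hj' with rfl | rfl <;>
      simp only [if_true, one_ne_zero, if_false, hd, hd', hea, heb, Units.val_one, mul_one]
    · exact s1
    · linear_combination W r b * W r b * s1 + s3
    · exact s2
    · linear_combination (-(W r a * W r' a)) * heq + (W r' a * W r' a) * s1 + s2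

/-! ### Semibiplanes of degree four -/

/-- An incidence relation in which two distinct rows that share a column share exactly two, two
distinct columns that share a row share exactly two, and no row or column has more than four
incidences. -/
structure IsSemibiplane {R C : Type*} (I : R → C → Prop) : Prop where
  row_two : ∀ r r' x, r ≠ r' → I r x → I r' x → ∃ y, y ≠ x ∧ I r y ∧ I r' y
  row_unique : ∀ r r' x y z, r ≠ r' → x ≠ y → I r x → I r' x → I r y → I r' y → I r z → I r' z →
    z = x ∨ z = y
  row_four : ∀ r a b c d, a ≠ b → a ≠ c → a ≠ d → b ≠ c → b ≠ d → c ≠ d → I r a → I r b → I r c →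
    I r d → ∀ x, I r x → x = a ∨ x = b ∨ x = c ∨ x = d
  col_two : ∀ x y r, x ≠ y → I r x → I r y → ∃ q, q ≠ r ∧ I q x ∧ I q y
  col_unique : ∀ x y r r' q, x ≠ y → r ≠ r' → I r x → I r' x → I r y → I r' y → I q x → I q y →
    q = r ∨ q = r'
  col_four : ∀ c r s t u, r ≠ s → r ≠ t → r ≠ u → s ≠ t → s ≠ u → t ≠ u → I r c → I s c → I t c →
    I u c → ∀ q, I q c → q = r ∨ q = s ∨ q = t ∨ q = u

set_option maxHeartbeats 1000000 in
/-- A semibiplane with a full row contains the support of `W₇` or of `W₈`. The six pairs of columns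
`a, b, c, d` of the full row `r0` determine six further rows `r1, …, r6`, dually the column `a`
determines three further columns `e, f, g`, and the remaining freedom is whether the row `r4`
through `b, c` passes through `e`. -/
theorem IsSemibiplane.exists_pattern {R C : Type*} {I : R → C → Prop} (h : IsSemibiplane I)
    {r0 : R} {a b c d : C} (hab : a ≠ b) (hac : a ≠ c) (had : a ≠ d) (hbc : b ≠ c) (hbd : b ≠ d)
    (hcd : c ≠ d) (ha : I r0 a) (hb : I r0 b) (hc : I r0 c) (hd : I r0 d) :
    (∃ (f : Fin 7 → R) (g : Fin 7 → C), Function.Injective g ∧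
      ∀ i j, blockW7 i j ≠ 0 → I (f i) (g j)) ∨
    ∃ (f : Fin 8 → R) (g : Fin 8 → C), Function.Injective g ∧
      ∀ i j, blockW8 i j ≠ 0 → I (f i) (g j) := by
  obtain ⟨row_two, row_unique, row_four, col_two, col_unique, col_four⟩ := h
  -- two rows that share `x` and `y` share no third column
  have cell : ∀ r x y, I r x → I r y → x ≠ y → ∀ r', r' ≠ r → I r' x → I r' y →
      ∀ z, z ≠ x → z ≠ y → I r z → ¬ I r' z := by
    intro r x y h1 h2 h3 r' h4 h5 h6 z h7 h8 h9 h10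
    rcases row_unique r r' x y z h4.symm h3 h1 h5 h2 h6 h9 h10 with h | h <;> contradiction
  -- the second row through each pair of columns of `r0`
  obtain ⟨r1, n01, h1a, h1b⟩ := col_two a b r0 hab ha hb
  obtain ⟨r2, n02, h2a, h2c⟩ := col_two a c r0 hac ha hc
  obtain ⟨r3, n03, h3a, h3d⟩ := col_two a d r0 had ha hd
  obtain ⟨r4, n04, h4b, h4c⟩ := col_two b c r0 hbc hb hc
  obtain ⟨r5, n05, h5b, h5d⟩ := col_two b d r0 hbd hb hd
  obtain ⟨r6, n06, h6c, h6d⟩ := col_two c d r0 hcd hc hd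
  have h1c := cell r0 a b ha hb hab r1 n01 h1a h1b c hac.symm hbc.symm hc
  have h1d := cell r0 a b ha hb hab r1 n01 h1a h1b d had.symm hbd.symm hd
  have h2b := cell r0 a c ha hc hac r2 n02 h2a h2c b hab.symm hbc hb
  have h2d := cell r0 a c ha hc hac r2 n02 h2a h2c d had.symm hcd.symm hd
  have h3b := cell r0 a d ha hd had r3 n03 h3a h3d b hab.symm hbd hb
  have h3c := cell r0 a d ha hd had r3 n03 h3a h3d c hac.symm hcd hc
  have h4a := cell r0 b c hb hc hbc r4 n04 h4b h4c a hab hac ha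
  have h4d := cell r0 b c hb hc hbc r4 n04 h4b h4c d hbd.symm hcd.symm hd
  have h5c := cell r0 b d hb hd hbd r5 n05 h5b h5d c hbc.symm hcd hc
  have h6b := cell r0 c d hc hd hcd r6 n06 h6c h6d b hbc hbd hb
  have n12 : r1 ≠ r2 := by rintro rfl; exact h1c h2c
  have n13 : r1 ≠ r3 := by rintro rfl; exact h1d h3d
  have n23 : r2 ≠ r3 := by rintro rfl; exact h2d h3d
  have n45 : r4 ≠ r5 := by rintro rfl; exact h4d h5d
  have n46 : r4 ≠ r6 := by rintro rfl; exact h4d h6d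
  have n56 : r5 ≠ r6 := by rintro rfl; exact h5c h6c
  have n14 : r1 ≠ r4 := by rintro rfl; exact h1c h4c
  have n15 : r1 ≠ r5 := by rintro rfl; exact h1d h5d
  have n24 : r2 ≠ r4 := by rintro rfl; exact h2b h4b
  have n26 : r2 ≠ r6 := by rintro rfl; exact h2d h6d
  have n35 : r3 ≠ r5 := by rintro rfl; exact h3b h5b
  have n36 : r3 ≠ r6 := by rintro rfl; exact h3c h6c
  -- the second column, besides `a`, of each pair of rows among `r1, r2, r3`
  obtain ⟨e, ea, h1e, h2e⟩ := row_two r1 r2 a n12 h1a h2a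
  obtain ⟨f, fa, h1f, h3f⟩ := row_two r1 r3 a n13 h1a h3a
  obtain ⟨g, ga, h2g, h3g⟩ := row_two r2 r3 a n23 h2a h3a
  have eb : e ≠ b := by rintro rfl; exact h2b h2e
  have ec : e ≠ c := by rintro rfl; exact h1c h1e
  have ed : e ≠ d := by rintro rfl; exact h1d h1e
  have fb : f ≠ b := by rintro rfl; exact h3b h3f
  have fc : f ≠ c := by rintro rfl; exact h1c h1f
  have fd : f ≠ d := by rintro rfl; exact h1d h1f
  have gb : g ≠ b := by rintro rfl; exact h2b h2g
  have gc : g ≠ c := by rintro rfl; exact h3c h3g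
  have gd : g ≠ d := by rintro rfl; exact h2d h2g
  have h3e : ¬ I r3 e := fun h => by
    rcases col_unique a e r1 r2 r3 ea.symm n12 h1a h2a h1e h2e h3a h with h | h
    exacts [n13 h.symm, n23 h.symm]
  have h2f : ¬ I r2 f := fun h => by
    rcases col_unique a f r1 r3 r2 fa.symm n13 h1a h3a h1f h3f h2a h with h | h
    exacts [n12 h.symm, n23 h]
  have h1g : ¬ I r1 g := fun h => by
    rcases col_unique a g r2 r3 r1 ga.symm n23 h2a h3a h2g h3g h1a h with h | h
    exacts [n12 h, n13 h]
  have ef : e ≠ f := by rintro rfl; exact h3e h3f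
  have eg : e ≠ g := by rintro rfl; exact h3e h3g
  have fg : f ≠ g := by rintro rfl; exact h2f h2g
  have h0x := row_four r0 a b c d hab hac had hbc hbd hcd ha hb hc hd
  have hxb := col_four b r0 r1 r4 r5 n01.symm n04.symm n05.symm n14 n15 n45 hb h1b h4b h5b
  have hxc := col_four c r0 r2 r4 r6 n02.symm n04.symm n06.symm n24 n26 n46 hc h2c h4c h6c
  have hxd := col_four d r0 r3 r5 r6 n03.symm n05.symm n06.symm n35 n36 n56 hd h3d h5d h6d
  have h1all := row_four r1 a b e f hab ea.symm fa.symm eb.symm fb.symm ef h1a h1b h1e h1f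
  have h2all := row_four r2 a c e g hac ea.symm ga.symm ec.symm gc.symm eg h2a h2c h2e h2g
  have h0e : ¬ I r0 e := fun h => by
    rcases h0x e h with h | h | h | h
    exacts [ea h, eb h, ec h, ed h]
  have h0f : ¬ I r0 f := fun h => by
    rcases h0x f h with h | h | h | h
    exacts [fa h, fb h, fc h, fd h]
  have h0g : ¬ I r0 g := fun h => by
    rcases h0x g h with h | h | h | h
    exacts [ga h, gb h, gc h, gd h]
  -- each of `e, f, g` lies in exactly one of two rows among `r4, r5, r6`, in two ways
  have ebx : I r4 e ∨ I r5 e := by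
    obtain ⟨q, hq, h1, h2⟩ := col_two b e r1 eb.symm h1b h1e
    rcases hxb q h1 with rfl | rfl | rfl | rfl
    exacts [absurd h2 h0e, absurd rfl hq, Or.inl h2, Or.inr h2]
  have ecx : I r4 e ∨ I r6 e := by
    obtain ⟨q, hq, h1, h2⟩ := col_two c e r2 ec.symm h2c h2e
    rcases hxc q h1 with rfl | rfl | rfl | rfl
    exacts [absurd h2 h0e, absurd rfl hq, Or.inl h2, Or.inr h2]
  have fbx : I r4 f ∨ I r5 f := by
    obtain ⟨q, hq, h1, h2⟩ := col_two b f r1 fb.symm h1b h1f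
    rcases hxb q h1 with rfl | rfl | rfl | rfl
    exacts [absurd h2 h0f, absurd rfl hq, Or.inl h2, Or.inr h2]
  have fdx : I r5 f ∨ I r6 f := by
    obtain ⟨q, hq, h1, h2⟩ := col_two d f r3 fd.symm h3d h3f
    rcases hxd q h1 with rfl | rfl | rfl | rfl
    exacts [absurd h2 h0f, absurd rfl hq, Or.inl h2, Or.inr h2]
  have gcx : I r4 g ∨ I r6 g := by
    obtain ⟨q, hq, h1, h2⟩ := col_two c g r2 gc.symm h2c h2g
    rcases hxc q h1 with rfl | rfl | rfl | rfl
    exacts [absurd h2 h0g, absurd rfl hq, Or.inl h2, Or.inr h2]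
  have gdx : I r5 g ∨ I r6 g := by
    obtain ⟨q, hq, h1, h2⟩ := col_two d g r3 gd.symm h3d h3g
    rcases hxd q h1 with rfl | rfl | rfl | rfl
    exacts [absurd h2 h0g, absurd rfl hq, Or.inl h2, Or.inr h2]
  have r4ef : I r4 e ∨ I r4 f := by
    obtain ⟨y, hy, h1, h2⟩ := row_two r1 r4 b n14 h1b h4b
    rcases h1all y h1 with rfl | rfl | rfl | rfl
    exacts [absurd h2 h4a, absurd rfl hy, Or.inl h2, Or.inr h2]
  have r4eg : I r4 e ∨ I r4 g := by
    obtain ⟨y, hy, h1, h2⟩ := row_two r2 r4 c n24 h2c h4c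
    rcases h2all y h1 with rfl | rfl | rfl | rfl
    exacts [absurd h2 h4a, absurd rfl hy, Or.inl h2, Or.inr h2]
  have n45e : ¬ (I r4 e ∧ I r5 e) := fun h => by
    rcases col_unique b e r4 r5 r1 eb.symm n45 h4b h5b h.1 h.2 h1b h1e with h | h
    exacts [n14 h, n15 h]
  have n46e : ¬ (I r4 e ∧ I r6 e) := fun h => by
    rcases col_unique c e r4 r6 r2 ec.symm n46 h4c h6c h.1 h.2 h2c h2e with h | h
    exacts [n24 h, n26 h]
  have n45f : ¬ (I r4 f ∧ I r5 f) := fun h => by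
    rcases col_unique b f r4 r5 r1 fb.symm n45 h4b h5b h.1 h.2 h1b h1f with h | h
    exacts [n14 h, n15 h]
  have n46g : ¬ (I r4 g ∧ I r6 g) := fun h => by
    rcases col_unique c g r4 r6 r2 gc.symm n46 h4c h6c h.1 h.2 h2c h2g with h | h
    exacts [n24 h, n26 h]
  have n4ef : ¬ (I r4 e ∧ I r4 f) := fun h => by
    rcases row_unique r1 r4 e f b n14 ef h1e h.1 h1f h.2 h1b h4b with h | h
    exacts [eb h.symm, fb h.symm]
  have n4eg : ¬ (I r4 e ∧ I r4 g) := fun h => by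
    rcases row_unique r2 r4 e g c n24 eg h2e h.1 h2g h.2 h2c h4c with h | h
    exacts [ec h.symm, gc h.symm]
  have key : (I r4 e ∧ I r5 f ∧ I r6 g ∧ ¬ I r4 f ∧ ¬ I r4 g ∧ ¬ I r5 e ∧ ¬ I r6 e) ∨
      (I r5 e ∧ I r6 e ∧ I r4 f ∧ I r6 f ∧ I r4 g ∧ I r5 g) := by
    by_cases h : I r4 e
    · have h5 : ¬ I r5 e := fun h' => n45e ⟨h, h'⟩
      have h6 : ¬ I r6 e := fun h' => n46e ⟨h, h'⟩
      have hf : ¬ I r4 f := fun h' => n4ef ⟨h, h'⟩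
      have hg : ¬ I r4 g := fun h' => n4eg ⟨h, h'⟩
      exact Or.inl ⟨h, fbx.resolve_left hf, gcx.resolve_left hg, hf, hg, h5, h6⟩
    · have hf := r4ef.resolve_left h
      have hg := r4eg.resolve_left h
      exact Or.inr ⟨ebx.resolve_left h, ecx.resolve_left h, hf,
        fdx.resolve_left fun h' => n45f ⟨hf, h'⟩, hg, gdx.resolve_right fun h' => n46g ⟨hg, h'⟩⟩
  rcases key with ⟨h4e, h5f, h6g, h4f, h4g, h5e, h6e⟩ | ⟨h5e, h6e, h4f, h6f, h4g, h5g⟩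
  · -- `r4, r5, r6` pairwise share a column `x` outside the known ones, and dually `e, f, g` pairwise
    -- share a row `s` outside the known ones
    right
    obtain ⟨x, xb, h4x, h5x⟩ := row_two r4 r5 b n45 h4b h5b
    have xc : x ≠ c := by rintro rfl; exact h5c h5x
    have xe : x ≠ e := by rintro rfl; exact h5e h5x
    have xa : x ≠ a := by rintro rfl; exact h4a h4x
    have xd : x ≠ d := by rintro rfl; exact h4d h4x
    have xf : x ≠ f := by rintro rfl; exact h4f h4x
    have xg : x ≠ g := by rintro rfl; exact h4g h4x
    have h4all := row_four r4 b c e x hbc eb.symm xb.symm ec.symm xc.symm xe.symm h4b h4c h4e h4x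
    have h6x : I r6 x := by
      obtain ⟨y, yc, h1, h2⟩ := row_two r4 r6 c n46 h4c h6c
      rcases h4all y h1 with rfl | rfl | rfl | rfl
      exacts [absurd h2 h6b, absurd rfl yc, absurd h2 h6e, h2]
    obtain ⟨s, ns1, hse, hsf⟩ := col_two e f r1 ef h1e h1f
    have ns2 : s ≠ r2 := by rintro rfl; exact h2f hsf
    have ns4 : s ≠ r4 := by rintro rfl; exact h4f hsf
    have hxe := col_four e r1 r2 r4 s n12 n14 ns1.symm n24 ns2.symm ns4.symm h1e h2e h4e hse
    have hsg : I s g := by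
      obtain ⟨q, hq, h1, h2⟩ := col_two e g r2 eg h2e h2g
      rcases hxe q h1 with rfl | rfl | rfl | rfl
      exacts [absurd h2 h1g, absurd rfl hq, absurd h2 h4g, h2]
    have h1x : ¬ I r1 x := fun h => by
      rcases h1all x h with h | h | h | h
      exacts [xa h, xb h, xe h, xf h]
    have h2x : ¬ I r2 x := fun h => by
      rcases h2all x h with h | h | h | h
      exacts [xa h, xc h, xe h, xg h]
    have hsx : I s x := by
      obtain ⟨q, hq, h1, h2⟩ := col_two e x r4 xe.symm h4e h4x
      rcases hxe q h1 with rfl | rfl | rfl | rfl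
      exacts [absurd h2 h1x, absurd h2 h2x, absurd rfl hq, h2]
    refine ⟨![r0, r1, r2, r3, r4, r5, r6, s], ![a, b, c, d, e, f, g, x], ?_, ?_⟩
    · intro i j hij
      fin_cases i <;> fin_cases j <;>
        first | rfl | exact absurd hij (by assumption) | exact absurd hij.symm (by assumption)
    · intro i j hij
      fin_cases i <;> fin_cases j <;> first | assumption | exact absurd rfl hij
  · left
    refine ⟨![r0, r1, r2, r3, r4, r5, r6], ![a, b, c, d, e, f, g], ?_, ?_⟩
    · intro i j hij
      fin_cases i <;> fin_cases j <;>
        first | rfl | exact absurd hij (by assumption) | exact absurd hij.symm (by assumption)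
    · intro i j hij
      fin_cases i <;> fin_cases j <;> first | assumption | exact absurd rfl hij

/-! ### Weighing matrices of weight four over `Fin n` -/

/-- A square matrix with orthogonal rows has orthogonal columns. -/
theorem IsWeighingMatrix.isWeightFour {n : ℕ} {W : Matrix (Fin n) (Fin n) ℤ}
    (h : IsWeighingMatrix 4 W) : IsWeightFour W := by
  obtain ⟨h1, h2⟩ := h
  have key : ∀ i j, ∑ k, W i k * W j k = if i = j then 4 else 0 := fun i j => by
    have := congrFun (congrFun h2 i) j
    simpa [Matrix.mul_apply, Matrix.one_apply] using this
  -- over `ℚ` the matrix `Wᵀ / 4` is a right inverse of `W`, hence a left inverse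
  have key' : ∀ i j, ∑ k, W k i * W k j = if i = j then 4 else 0 := by
    have e1 : W.map (Int.cast : ℤ → ℚ) * Matrix.of (fun i j => (W j i : ℚ) / 4) = 1 := by
      ext i j
      have := congrArg (Int.cast : ℤ → ℚ) (key i j)
      push_cast at this
      simp only [Matrix.mul_apply, Matrix.map_apply, Matrix.of_apply, mul_div_assoc',
        ← Finset.sum_div, this, Matrix.one_apply]
      split_ifs <;> norm_num
    intro i j
    have e0 := mul_eq_one_comm.1 e1
    have e2 := congrFun (congrFun e0 i) j
    simp only [Matrix.mul_apply, Matrix.map_apply, Matrix.of_apply, div_mul_eq_mul_div,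
      ← Finset.sum_div, Matrix.one_apply] at e2
    have e3 : ((∑ k, W k i * W k j : ℤ) : ℚ) = ((if i = j then 4 else 0 : ℤ) : ℚ) := by
      push_cast
      split_ifs at e2 ⊢ <;> linarith
    exact_mod_cast e3
  exact ⟨h1, fun r r' hr => by rw [key, if_neg hr], fun r => by rw [key, if_pos rfl],
    fun r r' hr => by rw [key', if_neg hr], fun r => by rw [key', if_pos rfl]⟩

theorem isWeighingMatrix_blockW7 : IsWeighingMatrix 4 blockW7 := by
  refine ⟨fun i => by fin_cases i <;> decide, by decide +kernel⟩

theorem isWeighingMatrix_blockW8 : IsWeighingMatrix 4 blockW8 := by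
  refine ⟨fun i => by fin_cases i <;> decide, by decide +kernel⟩

/-! ### Signs of the blocks `W₇` and `W₈` -/

/-- No `2 × 2` submatrix without zero entries has rank one. For entries `±1` the rank is one if and
only if the two columns of the submatrix have the same product of entries. -/
def NoRankOneBlock {R C : Type*} (W : Matrix R C ℤ) : Prop :=
  ∀ r r' a b, r ≠ r' → a ≠ b → W r a ≠ 0 → W r' a ≠ 0 → W r b ≠ 0 → W r' b ≠ 0 →
    W r a * W r' a ≠ W r b * W r' b

section NoRankOne

variable {R C : Type*} [Fintype R] [Fintype C] {W : Matrix R C ℤ}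

/-- If no `2 × 2` block without zeros has rank one, two rows take opposite products on any two
columns of their common support. -/
theorem IsWeightFour.mul_add_mul_eq_zero (h : IsWeightFour W)
    (hno : NoRankOneBlock W) {r r' : R} {a b : C} (hr : r ≠ r') (hab : a ≠ b)
    (h1 : W r a ≠ 0) (h2 : W r' a ≠ 0) (h3 : W r b ≠ 0) (h4 : W r' b ≠ 0) :
    W r a * W r' a + W r b * W r' b = 0 := by
  have h5 := sub_ne_zero.2 (hno r r' a b hr hab h1 h2 h3 h4)
  refine (mul_eq_zero.1 ?_).resolve_left h5
  linear_combination (W r' a * W r' a) * h.mul_self_eq_one h1 + h.mul_self_eq_one h2 -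
    (W r' b * W r' b) * h.mul_self_eq_one h3 - h.mul_self_eq_one h4

/-- Orthogonality forces a second common column of two rows that share one. -/
theorem IsWeightFour.exists_second (h : IsWeightFour W) {r r' : R} {x : C} (hr : r ≠ r')
    (h1 : W r x ≠ 0) (h2 : W r' x ≠ 0) : ∃ y, y ≠ x ∧ W r y ≠ 0 ∧ W r' y ≠ 0 := by
  by_contra! hne
  have h3 := h.row_orth r r' hr
  rw [Finset.sum_eq_single x] at h3
  · exact mul_ne_zero h1 h2 h3
  · intro y _ hy
    by_cases h4 : W r y = 0
    · simp [h4]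
    · simp [hne y hy h4]
  · simp

/-- Three common columns of two rows would carry pairwise opposite signs. -/
theorem IsWeightFour.eq_or_eq_of_common (h : IsWeightFour W)
    (hno : NoRankOneBlock W) {r r' : R} {x y z : C} (hr : r ≠ r') (hxy : x ≠ y)
    (h1 : W r x ≠ 0) (h2 : W r' x ≠ 0) (h3 : W r y ≠ 0) (h4 : W r' y ≠ 0) (h5 : W r z ≠ 0)
    (h6 : W r' z ≠ 0) : z = x ∨ z = y := by
  by_contra! hne
  have e1 := h.mul_add_mul_eq_zero hno hr hxy h1 h2 h3 h4
  have e2 := h.mul_add_mul_eq_zero hno hr hne.1 h5 h6 h1 h2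
  have e3 := h.mul_add_mul_eq_zero hno hr hne.2 h5 h6 h3 h4
  exact mul_ne_zero h1 h2 (by linarith)

/-- The support of a matrix without rank-one blocks is a semibiplane. -/
theorem IsWeightFour.isSemibiplane (h : IsWeightFour W)
    (hno : NoRankOneBlock W) : IsSemibiplane fun r c => W r c ≠ 0 := by
  have hno' : NoRankOneBlock W.transpose := by
    intro a b r r' hab hr h1 h2 h3 h4 h5
    change W r a * W r b = W r' a * W r' b at h5
    have h6 := h.mul_add_mul_eq_zero hno hr hab h1 h3 h2 h4
    have s1 := h.mul_self_eq_one h2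
    have s2 := h.mul_self_eq_one h3
    have h7 : W r a * W r' a = W r b * W r' b := by
      linear_combination (W r b * W r' a) * h5 - (W r a * W r' a) * s1 + (W r b * W r' b) * s2
    exact hno r r' a b hr hab h1 h3 h2 h4 h7
  refine ⟨fun r r' x hr h1 h2 => h.exists_second hr h1 h2,
    fun r r' x y z hr hxy h1 h2 h3 h4 h5 h6 => h.eq_or_eq_of_common hno hr hxy h1 h2 h3 h4 h5 h6, ?_,
    fun x y r hxy h1 h2 => h.transpose.exists_second hxy h1 h2, ?_, ?_⟩
  · intro r a b c d hab hac had hbc hbd hcd ha hb hc hd x hx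
    exact h.eq_of_ne_zero hab hac had hbc hbd hcd ha hb hc hd hx
  · intro x y r r' q hxy hr h1 h2 h3 h4 h5 h6
    exact h.transpose.eq_or_eq_of_common hno' hxy hr h1 h3 h2 h4 h5 h6
  · intro c r s t u hrs hrt hru hst hsu htu hr hs ht hu q hq
    exact h.transpose.eq_of_ne_zero hrs hrt hru hst hsu htu hr hs ht hu hq

/-- If the support of `B` is found in `W`, it is the exact support of `W` on these rows and
columns, because the rows of both matrices have four nonzero entries. -/
theorem IsWeightFour.apply_eq_zero_iff (h : IsWeightFour W) {k : ℕ} {B : Matrix (Fin k) (Fin k) ℤ}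
    (hB : IsWeightFour B) {f : Fin k → R} {g : Fin k → C} (hg : Function.Injective g)
    (hfg : ∀ i j, B i j ≠ 0 → W (f i) (g j) ≠ 0) (i j : Fin k) : W (f i) (g j) = 0 ↔ B i j = 0 := by
  refine ⟨fun h2 => by_contra fun h3 => hfg i j h3 h2, fun h2 => ?_⟩
  refine h.eq_zero_of_forall_ne hg (hB.card_support i).ge
    (fun k hk => hfg i k (Finset.mem_filter.1 hk).2) fun k hk h3 => ?_
  exact (Finset.mem_filter.1 hk).2 (hg h3 ▸ h2)

/-- Reduction of an embedding to a computation of signs: the rows and columns are rescaled one at a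
time, so it is enough that a rescaled matrix `N` agrees with `B`. -/
theorem IsWeightFour.embedsIn_of_sign (h : IsWeightFour W)
    (hno : NoRankOneBlock W) {k : ℕ} {B : Matrix (Fin k) (Fin k) ℤ}
    (hB : IsWeightFour B) (hsupp : ∀ i i', (∀ j, B i j = 0 ↔ B i' j = 0) → i = i')
    {f : Fin k → R} {g : Fin k → C} (hg : Function.Injective g)
    (hfg : ∀ i j, B i j ≠ 0 → W (f i) (g j) ≠ 0) (d e : Fin k → ℤˣ)
    (hN : ∀ N : Matrix (Fin k) (Fin k) ℤ, N = (Matrix.of fun i j => d i * W (f i) (g j) * e j) →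
      (∀ i i' j j', i ≠ i' → j ≠ j' → B i j ≠ 0 → B i' j ≠ 0 → B i j' ≠ 0 → B i' j' ≠ 0 →
        N i j * N i' j + N i j' * N i' j' = 0) → ∀ i j, B i j ≠ 0 → N i j = B i j) :
    EmbedsIn B W := by
  have sq (u : ℤˣ) : (u : ℤ) * u = 1 := by rcases Int.units_eq_one_or u with rfl | rfl <;> simp
  have hz := h.apply_eq_zero_iff hB hg hfg
  have hf : Function.Injective f := fun i i' hi => hsupp i i' fun j => by rw [← hz, ← hz, hi]
  refine ⟨f, g, d, e, hf, hg, fun i j => ?_⟩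
  by_cases hij : B i j = 0
  · rw [(hz i j).2 hij, hij, mul_zero, zero_mul]
  · rw [← hN _ rfl ?_ i j hij, Matrix.of_apply]
    · linear_combination (-W (f i) (g j)) * sq (d i) - W (f i) (g j) * (d i * d i : ℤ) * sq (e j)
    · intro i i' j j' hi hj h1 h2 h3 h4
      have h5 := h.mul_add_mul_eq_zero hno (hf.ne hi) (hg.ne hj) (hfg i j h1) (hfg i' j h2)
        (hfg i j' h3) (hfg i' j' h4)
      simp only [Matrix.of_apply]
      linear_combination (d i * d i' : ℤ) * h5 +
        (d i * d i' * W (f i) (g j) * W (f i') (g j) : ℤ) * sq (e j) +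
        (d i * d i' * W (f i) (g j') * W (f i') (g j') : ℤ) * sq (e j')

theorem IsWeightFour.entrySign_col (h : IsWeightFour W) {r : R} {c : C} (hne : W r c ≠ 0) (u : ℤˣ) :
    (u : ℤ) * W r c * ((entrySign (W r c) * u : ℤˣ) : ℤ) = 1 := by
  rw [Units.val_mul, entrySign_eq h hne]
  rcases Int.units_eq_one_or u with rfl | rfl <;> simp [h.mul_self_eq_one hne]

theorem IsWeightFour.entrySign_row (h : IsWeightFour W) {r : R} {c : C} (hne : W r c ≠ 0) (u : ℤˣ) :
    ((entrySign (W r c) * u : ℤˣ) : ℤ) * W r c * (u : ℤ) = 1 := by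
  rw [← h.entrySign_col hne u]; ring

/-- The support of `W₇` determines the signs: those along a spanning tree of the bipartite graph of
the support are normalised, and each other sign follows from a `2 × 2` block. -/
theorem IsWeightFour.embedsIn_blockW7 (h : IsWeightFour W)
    (hno : NoRankOneBlock W) {f : Fin 7 → R} {g : Fin 7 → C} (hg : Function.Injective g)
    (hfg : ∀ i j, blockW7 i j ≠ 0 → W (f i) (g j) ≠ 0) : EmbedsIn blockW7 W := by
  let s : Fin 7 → Fin 7 → ℤˣ := fun i j => entrySign (W (f i) (g j))
  let e0 := s 0 0 * 1
  let e1 := s 0 1 * 1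
  let e2 := s 0 2 * 1
  let e3 := s 0 3 * 1
  let d1 := s 1 0 * e0
  let d2 := s 2 0 * e0
  let d3 := s 3 0 * e0
  let e4 := s 1 4 * d1
  let e5 := s 1 5 * d1
  let e6 := s 2 6 * d2
  let d4 := s 4 1 * e1
  let d5 := s 5 1 * e1
  let d6 := s 6 2 * e2
  refine h.embedsIn_of_sign hno isWeighingMatrix_blockW7.isWeightFour
    (fun i i' => by fin_cases i <;> fin_cases i' <;> decide) hg hfg
    ![1, d1, d2, d3, d4, d5, d6] ![e0, e1, e2, e3, e4, e5, e6] fun N hN q => ?_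
  have col := fun i j hij => h.entrySign_col (hfg i j hij)
  have row := fun i j hij => h.entrySign_row (hfg i j hij)
  have n00 : N 0 0 = 1 := by rw [hN]; exact col 0 0 (by decide) _
  have n01 : N 0 1 = 1 := by rw [hN]; exact col 0 1 (by decide) _
  have n02 : N 0 2 = 1 := by rw [hN]; exact col 0 2 (by decide) _
  have n03 : N 0 3 = 1 := by rw [hN]; exact col 0 3 (by decide) _
  have n10 : N 1 0 = 1 := by rw [hN]; exact row 1 0 (by decide) _
  have n20 : N 2 0 = 1 := by rw [hN]; exact row 2 0 (by decide) _
  have n30 : N 3 0 = 1 := by rw [hN]; exact row 3 0 (by decide) _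
  have n14 : N 1 4 = 1 := by rw [hN]; exact col 1 4 (by decide) _
  have n15 : N 1 5 = 1 := by rw [hN]; exact col 1 5 (by decide) _
  have n26 : N 2 6 = 1 := by rw [hN]; exact col 2 6 (by decide) _
  have n41 : N 4 1 = 1 := by rw [hN]; exact row 4 1 (by decide) _
  have n51 : N 5 1 = 1 := by rw [hN]; exact row 5 1 (by decide) _
  have n62 : N 6 2 = 1 := by rw [hN]; exact row 6 2 (by decide) _
  clear hN
  replace q := fun i i' j j' (hp : i ≠ i' ∧ j ≠ j' ∧ blockW7 i j ≠ 0 ∧ blockW7 i' j ≠ 0 ∧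
    blockW7 i j' ≠ 0 ∧ blockW7 i' j' ≠ 0) => q i i' j j' hp.1 hp.2.1 hp.2.2.1 hp.2.2.2.1 hp.2.2.2.2.1
      hp.2.2.2.2.2
  have n11 : N 1 1 = -1 := by have := q 0 1 0 1 (by decide); simp [*] at this; linarith
  have n22 : N 2 2 = -1 := by have := q 0 2 0 2 (by decide); simp [*] at this; linarith
  have n33 : N 3 3 = -1 := by have := q 0 3 0 3 (by decide); simp [*] at this; linarith
  have n24 : N 2 4 = -1 := by have := q 1 2 0 4 (by decide); simp [*] at this; linarith
  have n35 : N 3 5 = -1 := by have := q 1 3 0 5 (by decide); simp [*] at this; linarith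
  have n36 : N 3 6 = -1 := by have := q 2 3 0 6 (by decide); simp [*] at this; linarith
  have n42 : N 4 2 = -1 := by have := q 0 4 1 2 (by decide); simp [*] at this; linarith
  have n45 : N 4 5 = 1 := by have := q 1 4 1 5 (by decide); simp [*] at this; linarith
  have n46 : N 4 6 = -1 := by have := q 2 4 2 6 (by decide); simp [*] at this; linarith
  have n53 : N 5 3 = -1 := by have := q 0 5 1 3 (by decide); simp [*] at this; linarith
  have n54 : N 5 4 = 1 := by have := q 1 5 1 4 (by decide); simp [*] at this; linarith
  have n56 : N 5 6 = 1 := by have := q 2 5 4 6 (by decide); simp [*] at this; linarith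
  have n63 : N 6 3 = -1 := by have := q 0 6 2 3 (by decide); simp [*] at this; linarith
  have n64 : N 6 4 = -1 := by have := q 2 6 2 4 (by decide); simp [*] at this; linarith
  have n65 : N 6 5 = 1 := by have := q 1 6 4 5 (by decide); simp [*] at this; linarith
  intro i j hij
  fin_cases i <;> fin_cases j <;> first | exact absurd rfl hij | assumption

/-- The support of `W₈` determines the signs. -/
theorem IsWeightFour.embedsIn_blockW8 (h : IsWeightFour W)
    (hno : NoRankOneBlock W) {f : Fin 8 → R} {g : Fin 8 → C} (hg : Function.Injective g)
    (hfg : ∀ i j, blockW8 i j ≠ 0 → W (f i) (g j) ≠ 0) : EmbedsIn blockW8 W := by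
  let s : Fin 8 → Fin 8 → ℤˣ := fun i j => entrySign (W (f i) (g j))
  let e0 := s 0 0 * 1
  let e1 := s 0 1 * 1
  let e2 := s 0 2 * 1
  let e3 := s 0 3 * 1
  let d1 := s 1 0 * e0
  let d2 := s 2 0 * e0
  let d3 := s 3 0 * e0
  let e4 := s 1 4 * d1
  let e5 := s 1 5 * d1
  let e6 := s 2 6 * d2
  let d4 := s 4 1 * e1
  let d5 := s 5 1 * e1
  let d6 := s 6 2 * e2
  let e7 := s 4 7 * d4
  let d7 := s 7 4 * e4
  refine h.embedsIn_of_sign hno isWeighingMatrix_blockW8.isWeightFour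
    (fun i i' => by fin_cases i <;> fin_cases i' <;> decide) hg hfg
    ![1, d1, d2, d3, d4, d5, d6, d7] ![e0, e1, e2, e3, e4, e5, e6, e7] fun N hN q => ?_
  have col := fun i j hij => h.entrySign_col (hfg i j hij)
  have row := fun i j hij => h.entrySign_row (hfg i j hij)
  have n00 : N 0 0 = 1 := by rw [hN]; exact col 0 0 (by decide) _
  have n01 : N 0 1 = 1 := by rw [hN]; exact col 0 1 (by decide) _
  have n02 : N 0 2 = 1 := by rw [hN]; exact col 0 2 (by decide) _
  have n03 : N 0 3 = 1 := by rw [hN]; exact col 0 3 (by decide) _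
  have n10 : N 1 0 = 1 := by rw [hN]; exact row 1 0 (by decide) _
  have n20 : N 2 0 = 1 := by rw [hN]; exact row 2 0 (by decide) _
  have n30 : N 3 0 = 1 := by rw [hN]; exact row 3 0 (by decide) _
  have n14 : N 1 4 = 1 := by rw [hN]; exact col 1 4 (by decide) _
  have n15 : N 1 5 = 1 := by rw [hN]; exact col 1 5 (by decide) _
  have n26 : N 2 6 = 1 := by rw [hN]; exact col 2 6 (by decide) _
  have n41 : N 4 1 = 1 := by rw [hN]; exact row 4 1 (by decide) _
  have n51 : N 5 1 = 1 := by rw [hN]; exact row 5 1 (by decide) _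
  have n62 : N 6 2 = 1 := by rw [hN]; exact row 6 2 (by decide) _
  have n47 : N 4 7 = 1 := by rw [hN]; exact col 4 7 (by decide) _
  have n74 : N 7 4 = 1 := by rw [hN]; exact row 7 4 (by decide) _
  clear hN
  replace q := fun i i' j j' (hp : i ≠ i' ∧ j ≠ j' ∧ blockW8 i j ≠ 0 ∧ blockW8 i' j ≠ 0 ∧
    blockW8 i j' ≠ 0 ∧ blockW8 i' j' ≠ 0) => q i i' j j' hp.1 hp.2.1 hp.2.2.1 hp.2.2.2.1 hp.2.2.2.2.1
      hp.2.2.2.2.2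
  have n11 : N 1 1 = -1 := by have := q 0 1 0 1 (by decide); simp [*] at this; linarith
  have n22 : N 2 2 = -1 := by have := q 0 2 0 2 (by decide); simp [*] at this; linarith
  have n33 : N 3 3 = -1 := by have := q 0 3 0 3 (by decide); simp [*] at this; linarith
  have n24 : N 2 4 = -1 := by have := q 1 2 0 4 (by decide); simp [*] at this; linarith
  have n35 : N 3 5 = -1 := by have := q 1 3 0 5 (by decide); simp [*] at this; linarith
  have n36 : N 3 6 = -1 := by have := q 2 3 0 6 (by decide); simp [*] at this; linarith
  have n42 : N 4 2 = -1 := by have := q 0 4 1 2 (by decide); simp [*] at this; linarith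
  have n44 : N 4 4 = 1 := by have := q 1 4 1 4 (by decide); simp [*] at this; linarith
  have n53 : N 5 3 = -1 := by have := q 0 5 1 3 (by decide); simp [*] at this; linarith
  have n55 : N 5 5 = 1 := by have := q 1 5 1 5 (by decide); simp [*] at this; linarith
  have n57 : N 5 7 = -1 := by have := q 4 5 1 7 (by decide); simp [*] at this; linarith
  have n63 : N 6 3 = -1 := by have := q 0 6 2 3 (by decide); simp [*] at this; linarith
  have n66 : N 6 6 = 1 := by have := q 2 6 2 6 (by decide); simp [*] at this; linarith
  have n67 : N 6 7 = 1 := by have := q 4 6 2 7 (by decide); simp [*] at this; linarith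
  have n75 : N 7 5 = -1 := by have := q 1 7 4 5 (by decide); simp [*] at this; linarith
  have n76 : N 7 6 = 1 := by have := q 2 7 4 6 (by decide); simp [*] at this; linarith
  have n77 : N 7 7 = -1 := by have := q 4 7 4 7 (by decide); simp [*] at this; linarith
  intro i j hij
  fin_cases i <;> fin_cases j <;> first | exact absurd rfl hij | assumption

end NoRankOne

/-- Every nonempty matrix of weight four contains one of the blocks. -/
theorem IsWeightFour.exists_block {R C : Type*} [Fintype R] [Fintype C] {W : Matrix R C ℤ}
    (h : IsWeightFour W) (r : R) : ∃ b : RealBlock, EmbedsIn b.matrix W := by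
  by_cases hno : NoRankOneBlock W
  · obtain ⟨a, b, hab, ha, hb⟩ := h.exists_two r
    obtain ⟨c, d, hcd, hac, had, hbc, hbd, hc, hd⟩ := h.exists_support hab ha hb
    rcases (h.isSemibiplane hno).exists_pattern hab hac had hbc hbd hcd ha hb hc hd with
      ⟨f, g, hg, hfg⟩ | ⟨f, g, hg, hfg⟩
    · exact ⟨.W7, h.embedsIn_blockW7 hno hg hfg⟩
    · exact ⟨.W8, h.embedsIn_blockW8 hno hg hfg⟩
  · unfold NoRankOneBlock at hno
    push Not at hno
    obtain ⟨r, r', a, b, hr, hab, ha, ha', hb, hb', heq⟩ := hno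
    obtain ⟨M, hM, hE⟩ := h.exists_blockE hr hab ha ha' hb hb' heq
    exact ⟨.E M hM, hE⟩

/-! ### Splitting off blocks -/

/-- Equivalence of matrices whose rows and columns are indexed by arbitrary types. For matrices over
`Fin n` it is `WeighingEquiv`. -/
def SignedPermEquiv {R C R' C' : Type*} (A : Matrix R C ℤ) (B : Matrix R' C' ℤ) : Prop :=
  ∃ (σ : R' ≃ R) (τ : C' ≃ C) (d : R' → ℤˣ) (e : C' → ℤˣ),
    ∀ i j, B i j = (d i : ℤ) * A (σ i) (τ j) * (e j : ℤ)

namespace SignedPermEquiv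

variable {R C R' C' R'' C'' : Type*} {A : Matrix R C ℤ} {B : Matrix R' C' ℤ} {D : Matrix R'' C'' ℤ}

theorem symm (h : SignedPermEquiv A B) : SignedPermEquiv B A := by
  obtain ⟨σ, τ, d, e, h⟩ := h
  have sq (u : ℤˣ) : (u : ℤ) * u = 1 := by rcases Int.units_eq_one_or u with rfl | rfl <;> simp
  refine ⟨σ.symm, τ.symm, fun i => d (σ.symm i), fun j => e (τ.symm j), fun i j => ?_⟩
  rw [h, Equiv.apply_symm_apply, Equiv.apply_symm_apply]
  linear_combination (-A i j) * sq (d (σ.symm i)) -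
    A i j * (d (σ.symm i) : ℤ) * (d (σ.symm i) : ℤ) * sq (e (τ.symm j))

theorem trans (h : SignedPermEquiv A B) (h' : SignedPermEquiv B D) : SignedPermEquiv A D := by
  obtain ⟨σ, τ, d, e, h⟩ := h
  obtain ⟨σ', τ', d', e', h'⟩ := h'
  refine ⟨σ'.trans σ, τ'.trans τ, fun i => d' i * d (σ' i), fun j => e (τ' j) * e' j, fun i j => ?_⟩
  rw [h', h]
  simp only [Equiv.trans_apply, Units.val_mul]
  ring

end SignedPermEquiv

theorem RealBlock.transpose_matrix (b : RealBlock) : b.matrix.transpose = b.matrix := by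
  cases b with
  | W7 => exact (by decide +kernel : blockW7.transpose = blockW7)
  | W8 => exact (by decide +kernel : blockW8.transpose = blockW8)
  | E m hm =>
    ext i j
    exact chainEntry_comm m 1 j i

theorem four_le_card_support_blockE {m : ℕ} (hm : 2 ≤ m) (i : Fin (2 * m)) :
    4 ≤ (Finset.univ.filter fun j => blockE m 1 i j ≠ 0).card := by
  obtain ⟨a, b, hab, hb, h1, h2, h3, h4⟩ := exists_chainEntry_ne_zero (x := 1) hm i.2 (by simp)
  let v : Fin 4 → Fin (2 * m) :=
    ![⟨a, by omega⟩, ⟨a + 1, by omega⟩, ⟨b, by omega⟩, ⟨b + 1, by omega⟩]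
  have hv : Function.Injective v := by
    intro k l hkl
    have := congrArg Fin.val hkl
    fin_cases k <;> fin_cases l <;> simp [v] at this ⊢ <;> omega
  rw [← Fintype.card_fin 4, ← Finset.card_univ, ← Finset.card_image_of_injective _ hv]
  apply Finset.card_le_card
  intro j hj
  obtain ⟨k, _, rfl⟩ := Finset.mem_image.1 hj
  refine Finset.mem_filter.2 ⟨Finset.mem_univ _, ?_⟩
  fin_cases k
  exacts [h1, h2, h3, h4]

theorem RealBlock.four_le_card_support (b : RealBlock) (i : Fin b.order) :
    4 ≤ (Finset.univ.filter fun j => b.matrix i j ≠ 0).card := by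
  cases b with
  | W7 => exact (isWeighingMatrix_blockW7.isWeightFour.card_support i).ge
  | W8 => exact (isWeighingMatrix_blockW8.isWeightFour.card_support i).ge
  | E m hm =>
    exact four_le_card_support_blockE hm i

namespace IsWeightFour

variable {R C : Type*} [Fintype R] [Fintype C] {W : Matrix R C ℤ}

/-- A row that passes through an embedded block vanishes outside the block. -/
theorem apply_eq_zero_of_embedded (h : IsWeightFour W) {k : ℕ} {B : Matrix (Fin k) (Fin k) ℤ}
    (hB : ∀ i, 4 ≤ (Finset.univ.filter fun j => B i j ≠ 0).card) {f : Fin k → R} {g : Fin k → C}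
    {d e : Fin k → ℤˣ} (hg : Function.Injective g)
    (hfg : ∀ i j, W (f i) (g j) = (d i : ℤ) * B i j * e j) (i : Fin k) {c : C}
    (hc : c ∉ Set.range g) : W (f i) c = 0 := by
  refine h.eq_zero_of_forall_ne hg (hB i) (fun j hj => ?_) fun j _ h1 => hc ⟨j, h1⟩
  simpa [hfg] using hj

/-- A diagonal block of a matrix of weight four has weight four. -/
theorem restrict (h : IsWeightFour W) (p : R → Prop) (q : C → Prop) [DecidablePred p]
    [DecidablePred q] (hr : ∀ r c, p r → ¬ q c → W r c = 0) (hc : ∀ r c, ¬ p r → q c → W r c = 0) :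
    IsWeightFour (W.submatrix (Subtype.val : {r // p r} → R) (Subtype.val : {c // q c} → C)) := by
  have rows : ∀ r r', p r → ∑ c : {c // q c}, W r c * W r' c = ∑ c, W r c * W r' c := by
    intro r r' h1
    rw [← Fintype.sum_subtype_add_sum_subtype q fun c => W r c * W r' c, left_eq_add]
    exact Finset.sum_eq_zero fun c _ => by rw [hr r c h1 c.2, zero_mul]
  have cols : ∀ c c', q c → ∑ r : {r // p r}, W r c * W r c' = ∑ r, W r c * W r c' := by
    intro c c' h1
    rw [← Fintype.sum_subtype_add_sum_subtype p fun r => W r c * W r c', left_eq_add]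
    exact Finset.sum_eq_zero fun r _ => by rw [hc r c r.2 h1, zero_mul]
  exact ⟨fun r c => h.entry r c,
    fun r r' hne => (rows r r' r.2).trans (h.row_orth _ _ fun h1 => hne (Subtype.ext h1)),
    fun r => (rows r r r.2).trans (h.row_norm r),
    fun c c' hne => (cols c c' c.2).trans (h.col_orth _ _ fun h1 => hne (Subtype.ext h1)),
    fun c => (cols c c c.2).trans (h.col_norm c)⟩

end IsWeightFour

/-- The function on the index type of a block sum with first block `b₀` that is `u` on the first
block and `v` on the others. -/
def consElim {k : ℕ} {α : Type*} (b₀ : RealBlock) (b : Fin k → RealBlock) (u : Fin b₀.order → α)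
    (v : (Σ i, Fin (b i).order) → α)
    (p : Σ i : Fin (k + 1), Fin ((Fin.cons b₀ b : Fin (k + 1) → RealBlock) i).order) : α :=
  Fin.cases (motive := fun i => Fin ((Fin.cons b₀ b : Fin (k + 1) → RealBlock) i).order → α) u
    (fun i x => v ⟨i, x⟩) p.1 p.2

theorem consElim_bijective {k : ℕ} {R : Type*} (b₀ : RealBlock) (b : Fin k → RealBlock)
    {f : Fin b₀.order → R} (hf : Function.Injective f)
    (σ : (Σ i, Fin (b i).order) ≃ {r // r ∉ Set.range f}) :
    Function.Bijective (consElim b₀ b f fun p => (σ p : R)) := by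
  constructor
  · rintro ⟨i, x⟩ ⟨j, y⟩ hij
    induction i using Fin.cases with
    | zero =>
      induction j using Fin.cases with
      | zero => exact congrArg (Sigma.mk (0 : Fin (k + 1))) (hf hij)
      | succ j => exact absurd ⟨x, hij⟩ (σ ⟨j, y⟩).2
    | succ i =>
      induction j using Fin.cases with
      | zero => exact absurd ⟨y, hij.symm⟩ (σ ⟨i, x⟩).2
      | succ j =>
        have h1 : (⟨i, x⟩ : Σ i, Fin (b i).order) = ⟨j, y⟩ := σ.injective (Subtype.ext hij)
        cases h1
        rfl
  · intro r
    by_cases hr : r ∈ Set.range f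
    · obtain ⟨x, rfl⟩ := hr
      exact ⟨⟨0, x⟩, rfl⟩
    · obtain ⟨⟨i, x⟩, h1⟩ := σ.surjective ⟨r, hr⟩
      exact ⟨⟨i.succ, x⟩, congrArg Subtype.val h1⟩

/-- Induction on the number of rows: a block found by `IsWeightFour.exists_block` is a direct summand,
because its rows and columns have no room for further nonzero entries, and the complement again has
weight four. -/
theorem IsWeightFour.exists_blockDiagonal {R C : Type*} [Fintype R] [Fintype C] {W : Matrix R C ℤ}
    (h : IsWeightFour W) : ∃ (k : ℕ) (b : Fin k → RealBlock),
      SignedPermEquiv W (Matrix.blockDiagonal' fun i => (b i).matrix) := by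
  classical
  induction hn : Fintype.card R using Nat.strong_induction_on generalizing R C with
  | _ n ih =>
    rcases isEmpty_or_nonempty R with hR | ⟨⟨r⟩⟩
    · have hC : IsEmpty C := ⟨fun c => by simpa using h.col_norm c⟩
      exact ⟨0, Fin.elim0, Equiv.equivOfIsEmpty _ _, Equiv.equivOfIsEmpty _ _, 1, 1,
        fun i => i.1.elim0⟩
    obtain ⟨b₀, f, g, d₀, e₀, hf, hg, hfg⟩ := h.exists_block r
    have hrow : ∀ x c, c ∉ Set.range g → W (f x) c = 0 := fun x c hc =>
      h.apply_eq_zero_of_embedded b₀.four_le_card_support hg hfg x hc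
    have hcol : ∀ x r, r ∉ Set.range f → W r (g x) = 0 := fun x r hr =>
      h.transpose.apply_eq_zero_of_embedded (d := e₀) (e := d₀) b₀.four_le_card_support hf
        (fun i j => by
          rw [Matrix.transpose_apply, hfg, ← Matrix.transpose_apply b₀.matrix, b₀.transpose_matrix]
          ring) x hr
    have hW := h.restrict (· ∉ Set.range f) (· ∉ Set.range g)
      (fun r c hr hc => by obtain ⟨x, rfl⟩ := not_not.1 hc; exact hcol x r hr)
      (fun r c hr hc => by obtain ⟨x, rfl⟩ := not_not.1 hr; exact hrow x c hc)
    have hpos : 0 < b₀.order := by cases b₀ <;> simp [RealBlock.order]; omega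
    obtain ⟨k, b, σ, τ, d, e, hb⟩ := ih _ (by
      rw [← hn]
      exact Fintype.card_subtype_lt (x := f ⟨0, hpos⟩) (by simp)) hW rfl
    have sq (u : ℤˣ) : (u : ℤ) * u = 1 := by rcases Int.units_eq_one_or u with rfl | rfl <;> simp
    refine ⟨k + 1, Fin.cons b₀ b, Equiv.ofBijective _ (consElim_bijective b₀ b hf σ),
      Equiv.ofBijective _ (consElim_bijective b₀ b hg τ), consElim b₀ b d₀ d, consElim b₀ b e₀ e, ?_⟩
    rintro ⟨i, x⟩ ⟨j, y⟩
    induction i using Fin.cases with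
    | zero =>
      induction j using Fin.cases with
      | zero =>
        have hxy : ∀ x y, b₀.matrix x y = d₀ x * W (f x) (g y) * e₀ y := fun x y => by
          rw [hfg]
          linear_combination (-b₀.matrix x y) * sq (d₀ x) -
            b₀.matrix x y * (d₀ x * d₀ x : ℤ) * sq (e₀ y)
        exact (Matrix.blockDiagonal'_apply_eq _ _ _ _).trans (hxy x y)
      | succ j =>
        rw [Matrix.blockDiagonal'_apply_ne _ _ _ (Fin.succ_ne_zero j).symm]
        change 0 = d₀ x * W (f x) (τ ⟨j, y⟩) * e ⟨j, y⟩
        rw [hrow x _ (τ ⟨j, y⟩).2, mul_zero, zero_mul]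
    | succ i =>
      induction j using Fin.cases with
      | zero =>
        rw [Matrix.blockDiagonal'_apply_ne _ _ _ (Fin.succ_ne_zero i)]
        change 0 = d ⟨i, x⟩ * W (σ ⟨i, x⟩) (g y) * e₀ y
        rw [hcol y _ (σ ⟨i, x⟩).2, mul_zero, zero_mul]
      | succ j =>
        refine Eq.trans ?_ (hb ⟨i, x⟩ ⟨j, y⟩)
        rcases eq_or_ne i j with rfl | hij
        · exact (Matrix.blockDiagonal'_apply_eq
            (fun i => ((Fin.cons b₀ b : Fin (k + 1) → RealBlock) i).matrix) i.succ x y).trans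
            (Matrix.blockDiagonal'_apply_eq (fun i => (b i).matrix) i x y).symm
        · exact (Matrix.blockDiagonal'_apply_ne
            (fun i => ((Fin.cons b₀ b : Fin (k + 1) → RealBlock) i).matrix) x y ((Fin.succ_injective k).ne hij)).trans
            (Matrix.blockDiagonal'_apply_ne (fun i => (b i).matrix) x y hij).symm

theorem SignedPermEquiv.eq_sum_order {n k : ℕ} {W : Matrix (Fin n) (Fin n) ℤ} {b : Fin k → RealBlock}
    (h : SignedPermEquiv W (Matrix.blockDiagonal' fun i => (b i).matrix)) :
    n = ∑ i, (b i).order := by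
  obtain ⟨σ, -⟩ := h
  simpa using (Fintype.card_congr σ).symm

/-! ### Orders for which matrices exist -/

/-- The direct sum of weighing matrices. -/
theorem exists_isWeighingMatrix_add {m n p : ℕ} (hm : ∃ W : Matrix (Fin m) (Fin m) ℤ,
    IsWeighingMatrix p W) (hn : ∃ W : Matrix (Fin n) (Fin n) ℤ, IsWeighingMatrix p W) :
    ∃ W : Matrix (Fin (m + n)) (Fin (m + n)) ℤ, IsWeighingMatrix p W := by
  obtain ⟨A, hA, hA'⟩ := hm
  obtain ⟨B, hB, hB'⟩ := hn
  refine ⟨(Matrix.fromBlocks A 0 0 B).submatrix finSumFinEquiv.symm finSumFinEquiv.symm,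
    fun i j => ?_, ?_⟩
  · rw [Matrix.submatrix_apply]
    rcases finSumFinEquiv.symm i with i | i <;> rcases finSumFinEquiv.symm j with j | j <;>
      simp [hA, hB]
  · rw [Matrix.transpose_submatrix, Matrix.submatrix_mul_equiv, Matrix.fromBlocks_transpose,
      Matrix.fromBlocks_multiply]
    simp only [Matrix.transpose_zero, Matrix.mul_zero, Matrix.zero_mul, add_zero,
      zero_add, hA', hB']
    have h1 : Matrix.fromBlocks ((p : ℤ) • (1 : Matrix (Fin m) (Fin m) ℤ)) 0 0
        ((p : ℤ) • (1 : Matrix (Fin n) (Fin n) ℤ)) = (p : ℤ) • 1 := by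
      rw [← Matrix.fromBlocks_one, Matrix.fromBlocks_smul, smul_zero, smul_zero]
    rw [h1, Matrix.submatrix_smul, Pi.smul_apply, Pi.smul_apply, Matrix.submatrix_one_equiv]

theorem isWeighingMatrix_blockE_two : IsWeighingMatrix 4 (blockE 2 1) := by
  refine ⟨fun (i : Fin 4) => by fin_cases i <;> decide +kernel, by decide +kernel⟩

theorem isWeighingMatrix_blockE_three : IsWeighingMatrix 4 (blockE 3 1) := by
  refine ⟨fun (i : Fin 6) => by fin_cases i <;> decide +kernel, by decide +kernel⟩

theorem exists_isWeighingMatrix_four (n : ℕ) (h4 : 4 ≤ n) (h5 : n ≠ 5) (h9 : n ≠ 9) :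
    ∃ W : Matrix (Fin n) (Fin n) ℤ, IsWeighingMatrix 4 W := by
  have e4 : ∃ W : Matrix (Fin 4) (Fin 4) ℤ, IsWeighingMatrix 4 W := ⟨_, isWeighingMatrix_blockE_two⟩
  have e6 : ∃ W : Matrix (Fin 6) (Fin 6) ℤ, IsWeighingMatrix 4 W :=
    ⟨_, isWeighingMatrix_blockE_three⟩
  have e7 : ∃ W : Matrix (Fin 7) (Fin 7) ℤ, IsWeighingMatrix 4 W := ⟨_, isWeighingMatrix_blockW7⟩
  -- the smallest orders in the four residue classes modulo `4` are `4`, `13`, `6` and `7`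
  induction n using Nat.strong_induction_on with
  | _ n ih =>
    have h1 : n = 4 ∨ n = 6 ∨ n = 7 ∨ n = 13 ∨ (4 ≤ n - 4 ∧ n - 4 ≠ 5 ∧ n - 4 ≠ 9) := by omega
    rcases h1 with rfl | rfl | rfl | rfl | ⟨h6, h7, h8⟩
    · exact e4
    · exact e6
    · exact e7
    · exact exists_isWeighingMatrix_add e6 e7
    · obtain ⟨k, rfl⟩ := Nat.exists_eq_add_of_le' h4
      rw [Nat.add_sub_cancel] at h6 h7 h8
      exact exists_isWeighingMatrix_add (ih k (by omega) h6 h7 h8) e4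

theorem RealBlock.sum_order_ne {k : ℕ} (b : Fin k → RealBlock) :
    ∑ i, (b i).order ≠ 5 ∧ ∑ i, (b i).order ≠ 9 := by
  -- neither `1`, `2`, `3`, `5` nor `9` is a sum of orders: removing one block from such a sum leaves
  -- another number of this list
  have key : ∀ s : Finset (Fin k), ∑ i ∈ s, (b i).order ≠ 1 ∧ ∑ i ∈ s, (b i).order ≠ 2 ∧
      ∑ i ∈ s, (b i).order ≠ 3 ∧ ∑ i ∈ s, (b i).order ≠ 5 ∧ ∑ i ∈ s, (b i).order ≠ 9 := by
    intro s
    induction s using Finset.induction_on with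
    | empty => simp
    | insert a s ha ih =>
      rw [Finset.sum_insert ha]
      have h1 : (b a).order = 7 ∨ (4 ≤ (b a).order ∧ (b a).order % 2 = 0) := by
        cases b a with
        | W7 => exact Or.inl rfl
        | W8 => exact Or.inr (by simp [RealBlock.order])
        | E m hm => exact Or.inr (by simp [RealBlock.order]; omega)
      omega
  exact (key Finset.univ).2.2.2

/-! ### Counting equivalence classes -/

theorem finite_realBlock_order_le (n : ℕ) : Finite {b : RealBlock // b.order ≤ n} := by
  let F : Bool ⊕ Fin n → RealBlock
    | .inl true => .W7
    | .inl false => .W8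
    | .inr m => if hm : 2 ≤ m.1 then .E m.1 hm else .W7
  refine ((Set.finite_range F).subset ?_).to_subtype
  intro b hb
  cases b with
  | W7 => exact ⟨.inl true, rfl⟩
  | W8 => exact ⟨.inl false, rfl⟩
  | E m hm =>
    have hb' : 2 * m ≤ n := hb
    exact ⟨.inr ⟨m, by omega⟩, dif_pos hm⟩

instance (n : ℕ) : Finite (BlockDecomposition n) := by
  have := finite_realBlock_order_le n
  have hfin := (List.finite_length_le {b : RealBlock // b.order ≤ n} n).to_subtype
  have hpos : ∀ b : RealBlock, 1 ≤ b.order := fun b => by cases b <;> simp [RealBlock.order]; omega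
  refine Finite.of_surjective
    (α := {l : {l : List {b : RealBlock // b.order ≤ n} | l.length ≤ n} //
      (((l.1.map Subtype.val : List RealBlock) : Multiset RealBlock).map RealBlock.order).sum = n})
    (fun l => ⟨_, l.2⟩) ?_
  rintro ⟨s, hs⟩
  induction s using Quotient.inductionOn with
  | _ l =>
    have hs' : (l.map RealBlock.order).sum = n := by simpa using hs
    have hle : ∀ b ∈ l, b.order ≤ n := fun b hb => by
      rw [← hs']
      exact List.le_sum_of_mem (List.mem_map_of_mem hb)
    have hlen : l.length ≤ n := by
      rw [← hs', ← List.length_map (f := RealBlock.order)]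
      exact List.length_le_sum_of_one_le _ fun i hi => by
        obtain ⟨b, _, rfl⟩ := List.mem_map.1 hi
        exact hpos b
    refine ⟨⟨⟨l.attach.map fun b => ⟨b.1, hle b.1 b.2⟩, by simpa using hlen⟩, ?_⟩, ?_⟩
    · simpa [Function.comp_def] using hs'
    · apply Subtype.ext
      simp [Function.comp_def]

/-- Families with the same multiset of values differ by a bijection of their index types. -/
theorem exists_equiv_of_map_univ_eq {ι κ α : Type*} [Fintype ι] [Fintype κ] {b : ι → α} {b' : κ → α}
    (h : Finset.univ.val.map b = Finset.univ.val.map b') : ∃ π : κ ≃ ι, ∀ i, b (π i) = b' i := by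
  classical
  have key : ∀ a, Nonempty ({i // b' i = a} ≃ {i // b i = a}) := fun a => by
    refine ⟨Fintype.equivOfCardEq ?_⟩
    have h1 := congrArg (Multiset.count a) h
    rw [Multiset.count_map, Multiset.count_map] at h1
    rw [Fintype.card_subtype, Fintype.card_subtype]
    simp only [eq_comm (a := a)] at h1
    exact h1.symm
  let φ := fun a => Classical.choice (key a)
  refine ⟨(Equiv.sigmaFiberEquiv b').symm.trans
    ((Equiv.sigmaCongrRight φ).trans (Equiv.sigmaFiberEquiv b)), fun i => ?_⟩
  exact (φ (b' i) ⟨i, rfl⟩).2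

/-- Up to equivalence a block sum does not depend on the order of the blocks. -/
theorem signedPermEquiv_blockDiagonal {k k' : ℕ} {b : Fin k → RealBlock} {b' : Fin k' → RealBlock}
    (h : Finset.univ.val.map b = Finset.univ.val.map b') :
    SignedPermEquiv (Matrix.blockDiagonal' fun i => (b i).matrix)
      (Matrix.blockDiagonal' fun i => (b' i).matrix) := by
  obtain ⟨π, hπ⟩ := exists_equiv_of_map_univ_eq h
  obtain rfl : (fun i => b (π i)) = b' := funext hπ
  refine ⟨Equiv.sigmaCongrLeft (β := fun i => Fin (b i).order) π,
    Equiv.sigmaCongrLeft (β := fun i => Fin (b i).order) π, 1, 1, ?_⟩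
  rintro ⟨i, x⟩ ⟨j, y⟩
  simp only [Pi.one_apply, Units.val_one, one_mul, mul_one]
  change _ = Matrix.blockDiagonal' (fun i => (b i).matrix) ⟨π i, x⟩ ⟨π j, y⟩
  rcases eq_or_ne i j with rfl | hij
  · rw [Matrix.blockDiagonal'_apply_eq, Matrix.blockDiagonal'_apply_eq]
  · rw [Matrix.blockDiagonal'_apply_ne _ _ _ hij,
      Matrix.blockDiagonal'_apply_ne _ _ _ (π.injective.ne hij)]

/-- Distinct equivalence classes have distinct multisets of blocks. -/
theorem exists_injective_blockDecomposition (n : ℕ) :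
    ∃ F : WeighingClass n 4 → BlockDecomposition n, Function.Injective F := by
  have key : ∀ q : WeighingClass n 4, ∃ (k : ℕ) (b : Fin k → RealBlock),
      SignedPermEquiv (Quotient.out q).1 (Matrix.blockDiagonal' fun i => (b i).matrix) :=
    fun q => (Quotient.out q).2.isWeightFour.exists_blockDiagonal
  choose k b hb using key
  refine ⟨fun q => ⟨Finset.univ.val.map (b q), ?_⟩, fun q q' hq => ?_⟩
  · rw [Multiset.map_map]
    exact (hb q).eq_sum_order.symm
  · have h1 := (hb q).trans
      ((signedPermEquiv_blockDiagonal (congrArg Subtype.val hq)).trans (hb q').symm)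
    exact Quotient.out_equiv_out.1 h1

theorem mainTheorem9 :
    -- every `W(n, 4)` is equivalent to a block diagonal matrix with blocks `W₇`, `W₈`, `E_{2m}(1)`
    (∀ (n : ℕ) (W : Matrix (Fin n) (Fin n) ℤ), IsWeighingMatrix 4 W →
      ∃ (k : ℕ) (b : Fin k → RealBlock) (h : n = ∑ i, (b i).order),
        WeighingEquiv W ((blockSum b).submatrix (finCongr h) (finCongr h))) ∧
    -- existence
    (∀ n : ℕ, 4 ≤ n →
      ((∃ W : Matrix (Fin n) (Fin n) ℤ, IsWeighingMatrix 4 W) ↔ n ≠ 5 ∧ n ≠ 9)) ∧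
    -- the number of inequivalent `W(n, 4)` is at most the number of decompositions of `n`
    (∀ n : ℕ, Finite (WeighingClass n 4) ∧ Finite (BlockDecomposition n) ∧
      Nat.card (WeighingClass n 4) ≤ Nat.card (BlockDecomposition n)) := by
  refine ⟨fun n W hW => ?_, fun n h4 => ⟨?_, fun h => exists_isWeighingMatrix_four n h4 h.1 h.2⟩,
    fun n => ?_⟩
  · obtain ⟨k, b, hb⟩ := hW.isWeightFour.exists_blockDiagonal
    have h := hb.eq_sum_order
    obtain ⟨σ, τ, d, e, hb⟩ := hb
    let φ := (finCongr h).trans (finSigmaFinEquiv (n := fun i => (b i).order)).symm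
    exact ⟨k, b, h, φ.trans σ, φ.trans τ, d ∘ φ, e ∘ φ, fun i j => hb (φ i) (φ j)⟩
  · rintro ⟨W, hW⟩
    obtain ⟨k, b, hb⟩ := hW.isWeightFour.exists_blockDiagonal
    rw [hb.eq_sum_order]
    exact RealBlock.sum_order_ne b
  · obtain ⟨F, hF⟩ := exists_injective_blockDecomposition n
    exact ⟨Finite.of_injective F hF, inferInstance, Nat.card_le_card_of_injective F hF⟩
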